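/- **Setting.** Let $K\ge 2$ and let $\nu_1,\dots,\nu_K$ be distributions on $[0,1]$ with means $\mu_k$, such that $0<\mu_k<1$ for all $k$ and a unique arm has the largest mean $\max_k\mu_k$. For each $k$ let $X_{k,1},X_{k,2},\dots$ be i.i.d. $[0,1]$-valued random variables with law $\nu_k$ (no independence across arms is required), and $\hat\mu_{k,s}=\frac1s\sum_{j=1}^s X_{k,j}$. If arms $A_1,A_2,\dots$ are played, $T_k(t)$ is the number of plays of $k$ up to time $t$; the $s$-th play of arm $k$ gives reward $X_{k,s}$. **Decision functions.** Let $g=\{g_t\}_{t\ge1}$ be real-valued functions $g_t(x,s)$, $x\in[0,1]$, $s\in\mathbb N=\{1,2,\dots\}$. For $0<x_1<x_2<1$ put $S_t(x_1,x_2)=\min\{s\in\mathbb N: g_t(x_1,s)\le x_2\}$; let $f(t)=1+t(\log t)^2$ and $d(p,q)=p\log\frac pq+(1-p)\log\frac{1-p}{1-q}$ (with $0\log 0=0$). Assume: 1. $g_t(x,s)$ is non-decreasing in $t$ and in $x$ and non-increasing in $s$. 2. $\lim_{s\to\infty}g_t(x,s)=x$ for all $x\in(0,1)$, $t\ge 1$.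 3. For all $x\in[0,1)$, $t\ge2$, $s\ge1$: $g_t(x,s)>x$, and if $g_t(x,s)<1$ then $d(x,g_t(x,s))\ge \log(f(t))/s$. 4. $\lim_{t\to\infty}S_t(x_1,x_2)/t=0$ for all $0<x_1<x_2<1$. 5. For all $0<x_1<x_2<1$ and every sequence $\delta_i\in\left(0,\min\{x_1,1-x_2,\frac{x_2-x_1}2\}\right)$ with $\delta_i\to0$, $$\lim_{i\to\infty}\lim_{t\to\infty}\frac{S_t(x_1+\delta_i,x_2-\delta_i)}{S_{\lceil(1-\delta_i)t\rceil}(x_1-\delta_i,x_2+\delta_i)}=1,$$ where the inner limits exist for every $i$. **Full-reward policy.** Play $\tilde A_t=t$ for $t\le K$ and $\tilde A_t\in\arg\max_k g_t(\hat\mu_{k,\tilde T_k(t-1)},\tilde T_k(t-1))$ for $t>K$, where $\tilde T_k$ counts the plays of $k$. Let $\tilde R_n(g)=\sum_{t=1}^n\mathbb E[\max_k\mu_k-\mu_{\tilde A_t}]$. **One-bit policy.** For integers $i,s,a\ge0$ let $\tau(i)=1+(i+1)\lceil\log_2(i+1)\rceil-2^{\lceil\log_2(i+1)\rceil}$, $\iota(s)=\max\{i\ge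 0:\tau(i)\le s\}$, $\Gamma_a(x)=\lceil2^ax\rceil-1$ for $x\in(0,1]$ and $\Gamma_a(0)=0$. For $s\ge 1$ let $\eta(s)=1+\tau(\iota(s)-1)$. Message policy $\pi^m$: after the $s$-th play of arm $k$, with $p=\tau(\iota(s-1))$, the bit $$M_{k,s}=\Gamma_{s-p}(\hat\mu_{k,1+p})-2\,\Gamma_{s-p-1}(\hat\mu_{k,1+p})\in\{0,1\}$$ is sent to the leader. The leader decodes $$\bar\mu_{k,s}=\sum_{s'=1+\tau(\iota(s)-1)}^{\tau(\iota(s))}2^{\tau(\iota(s)-1)-s'}M_{k,s'}+2^{\tau(\iota(s)-1)-\tau(\iota(s))}.$$ Arm policy $\pi^a(g)$: $A_t=t$ for $t\le K$ and $A_t\in\arg\max_k g_t(\bar\mu_{k,T_k(t-1)},\eta(T_k(t-1)))$ for $t>K$. Let $R_n(\pi^a(g),\pi^m)=\sum_{t=1}^n\mathbb E[\max_k\mu_k-\mu_{A_t}]$. In both policies ties in the argmax are broken by an arbitrary fixed rule depending on the set of maximizers and on the numbers of plays so far; the two rules may differ. **Theorem.** $\tilde R_n(g)>0$ for all $n\ge2$,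 and $$\limsup_{n\to\infty}\frac{R_n(\pi^a(g),\pi^m)}{\tilde R_n(g)}\le1 .$$ -/

import Mathlib

open MeasureTheory ProbabilityTheory Filter Topology

noncomputable section

namespace OneBit

/-! ### The sequential game

A follower at arm `k` sees the rewards of its own arm only.  At each time `t = 1, 2, …` the leader
selects an arm from what it has received so far; the selected arm produces its next reward and the
follower sends one symbol of type `β`, computed from the rewards of this arm up to now. -/

/-- At time `t`, the leader maps the symbols received so far (for each arm, in order of arrival)
to an arm. -/
abbrev ArmPolicy (K : ℕ) (β : Type) : Type := ℕ → (Fin K → List β) → Fin K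

/-- At time `t`, the follower at the selected arm maps the rewards of this arm observed so far,
the current one included, to one symbol. -/
abbrev MessagePolicy (β : Type) : Type := ℕ → List ℝ → β

variable {K : ℕ} {β : Type}

/-- What the leader has received from each arm after `t` rounds.  Here `x k j` is the reward of the
`(j+1)`-st pull of arm `k`; the number of pulls of arm `k` is the length of its list. -/
def received (πa : ArmPolicy K β) (πm : MessagePolicy β) (x : Fin K → ℕ → ℝ) :
    ℕ → Fin K → List β
  | 0 => fun _ => []
  | t + 1 =>
    let h := received πa πm x t
    let a := πa (t + 1) h
    Function.update h a
      (h a ++ [πm (t + 1) ((List.range ((h a).length + 1)).map (x a))])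

/-- The arm selected at time `t ≥ 1`. -/
def armAt (πa : ArmPolicy K β) (πm : MessagePolicy β) (x : Fin K → ℕ → ℝ) (t : ℕ) : Fin K :=
  πa t (received πa πm x (t - 1))

/-- The expected reward of each arm. -/
def armMean (ν : Fin K → Measure ℝ) (k : Fin K) : ℝ := ∫ y, y ∂(ν k)

/-- The regret after `n` rounds: the sum over `t = 1, …, n` of `E[max_k μ_k - μ_{A_t}]`, where
`μ` are the mean rewards and `X k j` is the reward of the `(j+1)`-st pull of arm `k`. -/
def regret {Ω : Type*} [MeasurableSpace Ω] (P : Measure Ω) (μ : Fin K → ℝ)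
    (X : Fin K → ℕ → Ω → ℝ) (πa : ArmPolicy K β) (πm : MessagePolicy β) (n : ℕ) : ℝ :=
  ∑ t ∈ Finset.Icc 1 n,
    ∫ ω, ((⨆ k, μ k) - μ (armAt πa πm (fun k j => X k j ω) t)) ∂P

/-! ### Index policies -/

/-- A rule that resolves ties in an argmax: it picks an element of every nonempty set of arms, and
may take the numbers of pulls of the arms so far (hence also the time) into account. -/
structure TieBreak (K : ℕ) where
  /-- The arm that is picked. -/
  pick : (Fin K → ℕ) → Finset (Fin K) → Fin K
  pick_mem : ∀ (T : Fin K → ℕ) (S : Finset (Fin K)), S.Nonempty → pick T S ∈ S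

open Classical in
/-- Play each arm once, in order, at times `1, …, K`; at every later time `t` play an arm whose
index `index t (symbols received from it)` is maximal. -/
def indexPolicy (tie : TieBreak K) (index : ℕ → List β → ℝ) : ArmPolicy K β := fun t h =>
  if ht : t - 1 < K then ⟨t - 1, ht⟩
  else tie.pick (fun k => (h k).length)
    (Finset.univ.filter fun k => ∀ j, index t (h j) ≤ index t (h k))

/-! ### Standard bandit: the reward itself is observed -/

/-- The follower transmits the current reward. -/
def fullReward : MessagePolicy ℝ := fun _ r => r.getLastD 0

/-- The upper confidence bound policy of the decision functions `g`, in the standard bandit: the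
index of an arm is `g_t` of its empirical mean and its number of pulls. -/
def ucbPolicy (g : ℕ → ℝ → ℕ → ℝ) (tie : TieBreak K) : ArmPolicy K ℝ :=
  indexPolicy tie fun t r => g t (r.sum / r.length) r.length

/-! ### The packet schedule -/

/-- The number of pulls after which the `i`-th packet is complete (`Nat.clog 2` is the rounded-up
binary logarithm; the subtraction does not truncate). -/
def tau (i : ℕ) : ℕ := 1 + (i + 1) * Nat.clog 2 (i + 1) - 2 ^ Nat.clog 2 (i + 1)

/-- The number of packets completed after `s` pulls, `max {i | tau i ≤ s}`. -/
def iota (s : ℕ) : ℕ := Nat.findGreatest (fun i => tau i ≤ s) s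

/-- The number of samples behind the most recent complete packet after `s ≥ 1` pulls. -/
def eta (s : ℕ) : ℕ := 1 + tau (iota s - 1)

/-- The quantizer `Γ_a`. -/
def Gam (a : ℕ) (x : ℝ) : ℤ := if x = 0 then 0 else ⌈(2 : ℝ) ^ a * x⌉ - 1

/-- The integer `Γ_{s-p}(x) - 2 Γ_{s-p-1}(x)`, with `s` the number of pulls, `p = tau (iota (s-1))`
and `x` the empirical mean of the first `1 + p` rewards. -/
def messageValue (r : List ℝ) : ℤ :=
  let p := tau (iota (r.length - 1))
  let x := (r.take (1 + p)).sum / (1 + p : ℕ)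
  Gam (r.length - p) x - 2 * Gam (r.length - p - 1) x

/-- The one-bit message policy: the bit is `messageValue`, which is `0` or `1` (see
`messageValue_eq_zero_or_one`). -/
def messagePolicy : MessagePolicy Bool := fun _ r => decide (messageValue r = 1)

/-- The leader's estimate of the mean of an arm, from the list of bits received from it. -/
def decode (m : List Bool) : ℝ :=
  let s := m.length
  (∑ i ∈ Finset.Icc (1 + tau (iota s - 1)) (tau (iota s)),
      (2 : ℝ) ^ ((tau (iota s - 1) : ℤ) - (i : ℤ)) * (if m.getD (i - 1) false then 1 else 0))
    + (2 : ℝ) ^ ((tau (iota s - 1) : ℤ) - (tau (iota s) : ℤ))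

/-- The leader's policy with one-bit feedback: the index of an arm is `g_t` of the decoded estimate
and of the number of samples behind this estimate. -/
def oneBitPolicy (g : ℕ → ℝ → ℕ → ℝ) (tie : TieBreak K) : ArmPolicy K Bool :=
  indexPolicy tie fun t m => g t (decode m) (eta m.length)

/-! ### Assumptions on the decision functions

`g t x s` is used for times `t ≥ 1`, averages `x ∈ [0, 1]` and numbers of pulls `s ≥ 1`. -/

/-- `g` is increasing in time and in the average, and decreasing in the number of pulls. -/
structure Monotonicity (g : ℕ → ℝ → ℕ → ℝ) : Prop where
  time : ∀ x ∈ Set.Icc (0 : ℝ) 1, ∀ s t t', 1 ≤ s → 1 ≤ t → t ≤ t' → g t x s ≤ g t' x s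
  average : ∀ x ∈ Set.Icc (0 : ℝ) 1, ∀ y ∈ Set.Icc (0 : ℝ) 1, ∀ s t, 1 ≤ s → 1 ≤ t → x ≤ y →
    g t x s ≤ g t y s
  pulls : ∀ x ∈ Set.Icc (0 : ℝ) 1, ∀ s s' t, 1 ≤ s → s ≤ s' → 1 ≤ t → g t x s' ≤ g t x s

/-- `g` converges to the average as the number of pulls grows. -/
def ConvergesToAverage (g : ℕ → ℝ → ℕ → ℝ) : Prop :=
  ∀ x ∈ Set.Ioo (0 : ℝ) 1, ∀ t, 1 ≤ t → Tendsto (fun s => g t x s) atTop (𝓝 x)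

/-- The exploration function `f(t) = 1 + t (log t)²`. -/
def explore (t : ℕ) : ℝ := 1 + (t : ℝ) * Real.log t ^ 2

/-- The Bernoulli Kullback–Leibler divergence, for `p ∈ [0, 1]` and `q ∈ (0, 1)`, where it is
finite; it is used for no other arguments. -/
def klBern (p q : ℝ) : ℝ := p * Real.log (p / q) + (1 - p) * Real.log ((1 - p) / (1 - q))

/-- `g` is sufficiently above the average. -/
def SufficientlyAbove (g : ℕ → ℝ → ℕ → ℝ) : Prop :=
  ∀ x ∈ Set.Ico (0 : ℝ) 1, ∀ t s, 2 ≤ t → 1 ≤ s →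
    x < g t x s ∧ (g t x s < 1 → Real.log (explore t) / s ≤ klBern x (g t x s))

/-- `S_t(x₁, x₂)`: the least number of pulls `s ≥ 1` with `g_t(x₁, s) ≤ x₂`; it exists as soon as
`g` converges to the average (see `exists_pulls`). -/
def pullsBelow (g : ℕ → ℝ → ℕ → ℝ) (t : ℕ) (x₁ x₂ : ℝ) : ℕ :=
  sInf {s | 1 ≤ s ∧ g t x₁ s ≤ x₂}

/-- `S_t(x₁, x₂) = o(t)`. -/
def Sublinear (g : ℕ → ℝ → ℕ → ℝ) : Prop :=
  ∀ x₁ x₂ : ℝ, 0 < x₁ → x₁ < x₂ → x₂ < 1 →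
    Tendsto (fun t : ℕ => (pullsBelow g t x₁ x₂ : ℝ) / t) atTop (𝓝 0)

/-- The iterated limit, first in `t` and then in `i`, of
`S_t(x₁ + δ_i, x₂ - δ_i) / S_⌈(1 - δ_i) t⌉(x₁ - δ_i, x₂ + δ_i)` exists and is `1`. -/
def AsymptoticContinuity (g : ℕ → ℝ → ℕ → ℝ) : Prop :=
  ∀ x₁ x₂ : ℝ, 0 < x₁ → x₁ < x₂ → x₂ < 1 → ∀ δ : ℕ → ℝ,
    (∀ i, 0 < δ i ∧ δ i < min x₁ (min (1 - x₂) ((x₂ - x₁) / 2))) → Tendsto δ atTop (𝓝 0) →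
    ∃ L : ℕ → ℝ,
      (∀ i, Tendsto (fun t : ℕ =>
          (pullsBelow g t (x₁ + δ i) (x₂ - δ i) : ℝ) /
            (pullsBelow g ⌈(1 - δ i) * (t : ℝ)⌉₊ (x₁ - δ i) (x₂ + δ i) : ℝ))
        atTop (𝓝 (L i))) ∧
      Tendsto L atTop (𝓝 1)

/-! ### Checks that the definitions mean what they should -/

theorem le_tau (i : ℕ) : i ≤ tau i := by
  unfold tau
  rcases Nat.eq_zero_or_pos i with rfl | hi
  · simp
  have h1 : 1 < i + 1 := by omega
  have hc : 0 < Nat.clog 2 (i + 1) := Nat.clog_pos (by norm_num) h1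
  have hlt : 2 ^ (Nat.clog 2 (i + 1)).pred < i + 1 := Nat.pow_pred_clog_lt_self (by norm_num) h1
  have hle : i + 1 ≤ 2 ^ Nat.clog 2 (i + 1) := Nat.le_pow_clog (by norm_num) _
  generalize Nat.clog 2 (i + 1) = c at *
  obtain ⟨d, rfl⟩ : ∃ d, c = d + 1 := ⟨c - 1, by omega⟩
  simp only [Nat.pred_succ, pow_succ] at *
  rcases d with _ | _ | d
  · simp at *; omega
  · simp at *; omega
  · have : (i + 1) * 3 ≤ (i + 1) * (d + 1 + 1 + 1) := Nat.mul_le_mul_left _ (by omega)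
    omega

theorem iota_isGreatest (s : ℕ) : IsGreatest {i | tau i ≤ s} (iota s) := by
  refine ⟨?_, fun i hi => Nat.le_findGreatest ((le_tau i).trans hi) hi⟩
  have h0 : tau 0 ≤ s := by simp [tau]
  exact Nat.findGreatest_spec (P := fun i => tau i ≤ s) (Nat.zero_le s) h0

theorem Gam_step (a : ℕ) (x : ℝ) :
    Gam (a + 1) x - 2 * Gam a x = 0 ∨ Gam (a + 1) x - 2 * Gam a x = 1 := by
  unfold Gam
  split_ifs with hx
  · simp
  · have e : (2 : ℝ) ^ (a + 1) * x = 2 * ((2 : ℝ) ^ a * x) := by ring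
    rw [e]
    generalize (2 : ℝ) ^ a * x = y
    have h1 := Int.le_ceil y
    have h2 := Int.ceil_lt_add_one y
    have h3 : ⌈2 * y⌉ ≤ 2 * ⌈y⌉ := Int.ceil_le.2 (by push_cast; linarith)
    have h4 : 2 * ⌈y⌉ - 2 < ⌈2 * y⌉ := Int.lt_ceil.2 (by push_cast; linarith)
    omega

theorem messageValue_eq_zero_or_one (r : List ℝ) (hr : r ≠ []) :
    messageValue r = 0 ∨ messageValue r = 1 := by
  have hl : 0 < r.length := List.length_pos_iff.2 hr
  have hp : tau (iota (r.length - 1)) ≤ r.length - 1 := (iota_isGreatest _).1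
  have e : r.length - tau (iota (r.length - 1))
      = (r.length - tau (iota (r.length - 1)) - 1) + 1 := by omega
  unfold messageValue
  simp only
  rw [e]
  exact Gam_step _ _

theorem exists_pulls {g : ℕ → ℝ → ℕ → ℝ} (hg : ConvergesToAverage g) {t : ℕ} (ht : 1 ≤ t)
    {x₁ x₂ : ℝ} (h0 : 0 < x₁) (h12 : x₁ < x₂) (h1 : x₂ < 1) :
    {s | 1 ≤ s ∧ g t x₁ s ≤ x₂}.Nonempty := by
  have h := (hg x₁ ⟨h0, h12.trans h1⟩ t ht).eventually (eventually_le_nhds h12)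
  obtain ⟨s, hs, hs1⟩ := (h.and (eventually_ge_atTop 1)).exists
  exact ⟨s, hs1, hs⟩

end OneBit

end

/-! Regret is the gap-weighted sum of expected pull counts (`regret_eq_sum`), so it suffices to
compare, for each suboptimal arm `k`, the expected pulls under the two policies up to a factor `c >
1`. Both are compared with the thresholds `pullsBelow`.

One-bit policy, upper bound (`exists_integral_pulls_oneBit_le`): a pull of `k` after the first `K`
rounds means that the best arm has a low index, or that the packet of `k` rests on fewer than
`S_n(μ_k + δ, μ* - δ)` samples, or that its estimate exceeds `μ_k + δ`. Decoding rounds the mean up,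
so quantization never lowers the index of the best arm, and a Chernoff bound makes the first event
summable over both rounds and pull counts. Rounding errors vanish and the packet delay is
logarithmic. In expectation only `(1 + ε) S_n + C` pulls remain.

Full-reward policy, lower bound (`eventually_le_integral_pulls_ucb`): with probability at least `1 -
ε` all averages over at least `s₀` pulls are accurate. An arm `k` with too few pulls then has an
index above `μ* + δ` throughout the last `δ n` rounds or so, while the other arms reach such an
index only sublinearly often. Those rounds cannot all be filled, so `k` has at least `S_⌈(1-δ)n⌉(μ_k
- δ, μ* + δ)` pulls.

Asymptotic continuity makes the two thresholds comparable for a suitable `δ`, and their divergence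
absorbs `C`. -/

namespace OneBit

/-! ### Pull counts and regret along a fixed path -/

section Game

variable {K : ℕ} {β : Type}

/-- The symbols received from an arm with rewards `x` after `s` pulls, when the symbol is a
time-independent function `m` of the rewards so far. -/
def sent (m : List ℝ → β) (x : ℕ → ℝ) (s : ℕ) : List β :=
  (List.range s).map fun i => m ((List.range (i + 1)).map x)

/-- The number of pulls of arm `k` in the first `t` rounds. -/
def pulls (πa : ArmPolicy K β) (πm : MessagePolicy β) (x : Fin K → ℕ → ℝ) (t : ℕ)
    (k : Fin K) : ℕ := (received πa πm x t k).length

variable (πa : ArmPolicy K β) (πm : MessagePolicy β) (m : List ℝ → β) (x : Fin K → ℕ → ℝ)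

@[simp] theorem length_sent (y : ℕ → ℝ) (s : ℕ) : (sent m y s).length = s := by simp [sent]

theorem pulls_zero (k : Fin K) : pulls πa πm x 0 k = 0 := by simp [pulls, received]

theorem pulls_succ (t : ℕ) (k : Fin K) :
    pulls πa πm x (t + 1) k
      = pulls πa πm x t k + if armAt πa πm x (t + 1) = k then 1 else 0 := by
  by_cases h : armAt πa πm x (t + 1) = k
  · subst h
    simp [pulls, received, armAt]
  · have h' : k ≠ πa (t + 1) (received πa πm x t) := fun e => h e.symm
    simp [pulls, received, h, Function.update_of_ne h']

theorem pulls_mono (k : Fin K) : Monotone fun t => pulls πa πm x t k :=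
  monotone_nat_of_le_succ fun t => by rw [pulls_succ]; omega

theorem sum_pulls (t : ℕ) : ∑ k, pulls πa πm x t k = t := by
  induction t with
  | zero => simp [pulls_zero]
  | succ t ih => simp [pulls_succ, Finset.sum_add_distrib, ih]

theorem pulls_le (t : ℕ) (k : Fin K) : pulls πa πm x t k ≤ t := by
  conv_rhs => rw [← sum_pulls πa πm x t]
  exact Finset.single_le_sum (f := fun k => pulls πa πm x t k) (fun _ _ => Nat.zero_le _)
    (Finset.mem_univ k)

/-- Each arm has its own reward sequence, so what the leader holds from it depends only on that
sequence and on the pull count. Indices can therefore be studied at a deterministic number of pulls.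
-/
theorem received_eq_sent (t : ℕ) (k : Fin K) :
    received πa (fun _ => m) x t k = sent m (x k) (pulls πa (fun _ => m) x t k) := by
  induction t with
  | zero => simp [pulls_zero, sent, received]
  | succ t ih =>
    rw [pulls_succ]
    by_cases h : armAt πa (fun _ => m) x (t + 1) = k
    · have h' : πa (t + 1) (received πa (fun _ => m) x t) = k := h
      rw [if_pos h, sent, List.range_succ, List.map_append, ← sent, ← ih]
      simp [received, h', pulls]
    · have h' : k ≠ πa (t + 1) (received πa (fun _ => m) x t) := fun e => h e.symm
      simp [received, h, Function.update_of_ne h', ih]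

/-- The regret along a path is a combination of the numbers of pulls. -/
theorem sum_gap_eq (μ : Fin K → ℝ) (M : ℝ) (n : ℕ) :
    ∑ t ∈ Finset.Icc 1 n, (M - μ (armAt πa πm x t))
      = ∑ k, (M - μ k) * pulls πa πm x n k := by
  induction n with
  | zero => simp [pulls_zero]
  | succ n ih =>
    rw [Finset.sum_Icc_succ_top (by omega), ih]
    simp [pulls_succ, mul_add, Finset.sum_add_distrib]

section Index

variable (tie : TieBreak K) (index : ℕ → List β → ℝ)

theorem armAt_initial {t : ℕ} (ht : t < K) :
    armAt (indexPolicy tie index) πm x (t + 1) = ⟨t, ht⟩ := by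
  simp [armAt, indexPolicy, ht]

theorem index_le_index_armAt {t : ℕ} (ht : K ≤ t) {k : Fin K}
    (hk : armAt (indexPolicy tie index) (fun _ => m) x (t + 1) = k) (j : Fin K) :
    index (t + 1) (sent m (x j) (pulls (indexPolicy tie index) (fun _ => m) x t j))
      ≤ index (t + 1) (sent m (x k) (pulls (indexPolicy tie index) (fun _ => m) x t k)) := by
  classical
  subst hk
  have hK : 0 < K := (Nat.zero_le _).trans_lt j.2
  have : Nonempty (Fin K) := ⟨j⟩
  simp only [← received_eq_sent]
  set h := received (indexPolicy tie index) (fun _ => m) x t with hh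
  have e : armAt (indexPolicy tie index) (fun _ => m) x (t + 1)
      = tie.pick (fun k => (h k).length)
        (Finset.univ.filter fun k => ∀ j, index (t + 1) (h j) ≤ index (t + 1) (h k)) := by
    have : ¬ t < K := by omega
    simp only [armAt, indexPolicy, Nat.add_sub_cancel, this, dite_false, ← hh]
  have hne : (Finset.univ.filter fun k =>
      ∀ j, index (t + 1) (h j) ≤ index (t + 1) (h k)).Nonempty := by
    obtain ⟨k, hk⟩ := Finite.exists_max fun k => index (t + 1) (h k)
    exact ⟨k, by simpa using hk⟩
  have := tie.pick_mem (fun k => (h k).length) _ hne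
  rw [← e] at this
  exact (Finset.mem_filter.1 this).2 j

theorem one_le_pulls {t : ℕ} (ht : K ≤ t) (k : Fin K) :
    1 ≤ pulls (indexPolicy tie index) πm x t k := by
  have h : 1 ≤ pulls (indexPolicy tie index) πm x (k + 1) k := by
    rw [pulls_succ, armAt_initial πm x tie index k.2]
    simp
  exact h.trans (pulls_mono _ _ _ k (by have := k.2; omega))

end Index

end Game

/-! ### Measurability of the game and the regret decomposition -/

section Measurability

variable {K : ℕ} {β : Type} {Ω : Type*} [MeasurableSpace Ω]

theorem measurable_comp_countable {ι α : Type*} [MeasurableSpace ι] [Countable ι]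
    [MeasurableSingletonClass ι] [MeasurableSpace α] {F : ι → Ω → α} {N : Ω → ι}
    (hF : ∀ i, Measurable (F i)) (hN : Measurable N) : Measurable fun ω => F (N ω) ω :=
  (measurable_from_prod_countable_right (f := fun p : ι × Ω => F p.1 p.2) hF).comp
    (hN.prodMk measurable_id)

variable (tie : TieBreak K) (index : ℕ → List β → ℝ) (m : List ℝ → β)
  (X : Fin K → ℕ → Ω → ℝ)

/-- Joint induction on time: the next arm is determined by the current pull counts and the
comparisons between indices, and it determines the next pull counts. -/
theorem measurable_pulls_and_armAt
    (h : ∀ t k s, Measurable fun ω => index (t + 1) (sent m (fun j => X k j ω) s)) (t : ℕ) :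
    Measurable (fun ω => pulls (indexPolicy tie index) (fun _ => m) (fun k j => X k j ω) t) ∧
    Measurable
      (fun ω => armAt (indexPolicy tie index) (fun _ => m) (fun k j => X k j ω) (t + 1)) := by
  classical
  have key : ∀ t, Measurable
      (fun ω => pulls (indexPolicy tie index) (fun _ => m) (fun k j => X k j ω) t) →
      Measurable
      (fun ω => armAt (indexPolicy tie index) (fun _ => m) (fun k j => X k j ω) (t + 1)) := by
    intro t ht
    by_cases htK : t < K
    · simp only [armAt_initial _ _ tie index htK]
      exact measurable_const
    -- For fixed counts the choice factors through the finite type of comparison relations, on which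
    -- every function is measurable. The random counts take countably many values.
    · let G : (Fin K → ℕ) → (Fin K → Fin K → Prop) → Fin K := fun v r =>
        tie.pick v (Finset.univ.filter fun k => ∀ j, r j k)
      have e : (fun ω => armAt (indexPolicy tie index) (fun _ => m) (fun k j => X k j ω) (t + 1))
          = fun ω => (fun (v : Fin K → ℕ) (ω : Ω) => G v fun j k =>
            index (t + 1) (sent m (fun i => X j i ω) (v j))
              ≤ index (t + 1) (sent m (fun i => X k i ω) (v k)))
            (pulls (indexPolicy tie index) (fun _ => m) (fun k j => X k j ω) t) ω := by
        funext ω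
        simp only [G, armAt, indexPolicy, Nat.add_sub_cancel, htK, dite_false]
        congr
        simp only [received_eq_sent]
      rw [e]
      refine measurable_comp_countable (ι := Fin K → ℕ) (F := fun v ω => G v fun j k =>
        index (t + 1) (sent m (fun i => X j i ω) (v j))
          ≤ index (t + 1) (sent m (fun i => X k i ω) (v k))) (fun v => ?_) ht
      refine (measurable_of_countable (G v)).comp ?_
      refine measurable_pi_lambda _ fun j => measurable_pi_lambda _ fun k => ?_
      exact measurableSet_setOfPred.1 (measurableSet_le (h t j (v j)) (h t k (v k)))
  refine ⟨?_, key t ?_⟩ <;>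
  · induction t with
    | zero => simp only [show ∀ ω, pulls (indexPolicy tie index) (fun _ => m)
        (fun k j => X k j ω) 0 = fun _ => 0 from fun ω => funext (pulls_zero _ _ _)]
              exact measurable_const
    | succ t ih =>
      refine measurable_pi_lambda _ fun k => ?_
      simp only [pulls_succ]
      exact ((measurable_pi_apply k).comp ih).add
        (Measurable.ite ((key t ih) (measurableSet_singleton k)) measurable_const measurable_const)

theorem measurable_pulls
    (h : ∀ t k s, Measurable fun ω => index (t + 1) (sent m (fun j => X k j ω) s))
    (t : ℕ) (k : Fin K) : Measurable fun ω =>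
    (pulls (indexPolicy tie index) (fun _ => m) (fun k j => X k j ω) t k : ℝ) :=
  measurable_from_nat.comp ((measurable_pi_apply k).comp
    (measurable_pulls_and_armAt tie index m X h t).1)

variable (P : Measure Ω) [IsProbabilityMeasure P]

theorem integrable_pulls
    (h : ∀ t k s, Measurable fun ω => index (t + 1) (sent m (fun j => X k j ω) s))
    (t : ℕ) (k : Fin K) : Integrable (fun ω =>
    (pulls (indexPolicy tie index) (fun _ => m) (fun k j => X k j ω) t k : ℝ)) P :=
  .of_bound (measurable_pulls tie index m X h t k).aestronglyMeasurable t <| .of_forall fun ω => by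
    simpa using pulls_le _ _ _ t k

theorem regret_eq_sum
    (h : ∀ t k s, Measurable fun ω => index (t + 1) (sent m (fun j => X k j ω) s))
    (μ : Fin K → ℝ) (n : ℕ) :
    regret P μ X (indexPolicy tie index) (fun _ => m) n
      = ∑ k, ((⨆ j, μ j) - μ k) *
        ∫ ω, (pulls (indexPolicy tie index) (fun _ => m) (fun k j => X k j ω) n k : ℝ) ∂P := by
  have hint : ∀ t ∈ Finset.Icc 1 n, Integrable (fun ω => (⨆ k, μ k) -
      μ (armAt (indexPolicy tie index) (fun _ => m) (fun k j => X k j ω) t)) P := by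
    intro t ht
    obtain ⟨t, rfl⟩ : ∃ s, t = s + 1 := ⟨t - 1, by have := (Finset.mem_Icc.1 ht).1; omega⟩
    have hA := (measurable_pulls_and_armAt tie index m X h t).2
    refine (integrable_const _).sub (.of_bound
      ((measurable_of_countable μ).comp hA).aestronglyMeasurable (∑ k, |μ k|) (.of_forall ?_))
    exact fun ω => Finset.single_le_sum (f := fun k => |μ k|) (fun _ _ => abs_nonneg _)
      (Finset.mem_univ _)
  rw [regret, ← integral_finsetSum _ hint]
  simp only [sum_gap_eq]
  rw [integral_finsetSum _ fun k _ => (integrable_pulls tie index m X P h n k).const_mul _]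
  simp only [integral_const_mul]

end Measurability

/-! ### Bernoulli divergence -/

section KullbackLeibler

/-- The entropy terms in `x` cancel in the difference, which leaves an expression affine in `x`. -/
theorem klBern_eq_add {x y q : ℝ} (hx0 : 0 ≤ x) (hx1 : x < 1) (hy : y ∈ Set.Ioo (0 : ℝ) 1)
    (hq : q ∈ Set.Ioo (0 : ℝ) 1) :
    klBern x q = klBern x y
      + (x * Real.log (y / q) + (1 - x) * Real.log ((1 - y) / (1 - q))) := by
  have hy1 : 1 - y ≠ 0 := by linarith [hy.2]
  have hq1 : 1 - q ≠ 0 := by linarith [hq.2]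
  have hx2 : 1 - x ≠ 0 := by linarith
  have hy0 := hy.1.ne'
  have hq0 := hq.1.ne'
  unfold klBern
  rw [Real.log_div hx2 hq1, Real.log_div hx2 hy1, Real.log_div hy1 hq1, Real.log_div hy0 hq0]
  rcases hx0.eq_or_lt with rfl | hx
  · ring
  · rw [Real.log_div hx.ne' hq0, Real.log_div hx.ne' hy0]
    ring

theorem klBern_self {q : ℝ} (hq : q ∈ Set.Ioo (0 : ℝ) 1) : klBern q q = 0 := by
  have hq1 : 1 - q ≠ 0 := by linarith [hq.2]
  simp [klBern, div_self hq1, div_self hq.1.ne']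

theorem klBern_pos {x q : ℝ} (hx0 : 0 ≤ x) (hx1 : x < 1) (hq : q ∈ Set.Ioo (0 : ℝ) 1)
    (hne : x ≠ q) : 0 < klBern x q := by
  have hq1 : 0 < 1 - q := by linarith [hq.2]
  have hx2 : 0 < 1 - x := by linarith
  -- Strictness is taken from this term because the other one vanishes at `x = 0`.
  have h2 : Real.log ((1 - q) / (1 - x)) < (1 - q) / (1 - x) - 1 :=
    Real.log_lt_sub_one_of_pos (by positivity) fun h => hne (by
      rw [div_eq_one_iff_eq hx2.ne'] at h; linarith)
  have e2 : Real.log ((1 - x) / (1 - q)) = - Real.log ((1 - q) / (1 - x)) := by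
    rw [← Real.log_inv, inv_div]
  have h2' : (1 - x) * Real.log ((1 - q) / (1 - x)) < (1 - q) - (1 - x) := by
    calc _ < (1 - x) * ((1 - q) / (1 - x) - 1) := by gcongr
      _ = _ := by field_simp
  unfold klBern
  rw [e2]
  rcases hx0.eq_or_lt with rfl | hx
  · linarith [hq.1]
  · have h1 : Real.log (q / x) ≤ q / x - 1 :=
      Real.log_le_sub_one_of_pos (div_pos hq.1 hx)
    have e1 : Real.log (x / q) = - Real.log (q / x) := by rw [← Real.log_inv, inv_div]
    have h1' : x * Real.log (q / x) ≤ q - x := by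
      calc _ ≤ x * (q / x - 1) := by gcongr
        _ = _ := by field_simp
    rw [e1]
    linarith

theorem klBern_nonneg {x q : ℝ} (hx0 : 0 ≤ x) (hx1 : x < 1) (hq : q ∈ Set.Ioo (0 : ℝ) 1) :
    0 ≤ klBern x q := by
  rcases eq_or_ne x q with rfl | h
  · exact (klBern_self hq).ge
  · exact (klBern_pos hx0 hx1 hq h).le

/-- The affine remainder of `klBern_eq_add` is non-increasing in `x` when `y ≤ q`, and its value at
`x = y` is `klBern y q`. -/
theorem klBern_add_le {x y q : ℝ} (hx0 : 0 ≤ x) (hxy : x ≤ y) (hy0 : 0 < y) (hyq : y ≤ q)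
    (hq1 : q < 1) : klBern x y + klBern y q ≤ klBern x q := by
  have hy1 := hyq.trans_lt hq1
  have hq0 := hy0.trans_le hyq
  rw [klBern_eq_add hx0 (hxy.trans_lt hy1) ⟨hy0, hy1⟩ ⟨hq0, hq1⟩]
  have h1 : Real.log (y / q) ≤ 0 :=
    Real.log_nonpos (by positivity) (div_le_one_of_le₀ hyq hq0.le)
  have h2 : 0 ≤ Real.log ((1 - y) / (1 - q)) :=
    Real.log_nonneg ((one_le_div (by linarith)).2 (by linarith))
  unfold klBern
  nlinarith [mul_le_mul_of_nonpos_right hxy h1, mul_le_mul_of_nonneg_right hxy h2]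

theorem klBern_anti_left {x y q : ℝ} (hx0 : 0 ≤ x) (hxy : x ≤ y) (hyq : y ≤ q)
    (hq1 : q < 1) : klBern y q ≤ klBern x q := by
  rcases hxy.eq_or_lt with rfl | h
  · exact le_rfl
  · have hy0 := hx0.trans_lt h
    have hy1 := hyq.trans_lt hq1
    linarith [klBern_add_le hx0 hxy hy0 hyq hq1,
      klBern_nonneg hx0 (hxy.trans_lt hy1) ⟨hy0, hy1⟩]

theorem klBern_mono_right {x y q : ℝ} (hx0 : 0 ≤ x) (hxy : x ≤ y) (hy0 : 0 < y) (hyq : y ≤ q)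
    (hq1 : q < 1) : klBern x y ≤ klBern x q := by
  linarith [klBern_add_le hx0 hxy hy0 hyq hq1,
    klBern_nonneg hy0.le (hyq.trans_lt hq1) ⟨hy0.trans_le hyq, hq1⟩]

theorem continuousOn_klBern_left {q : ℝ} (hq : q ∈ Set.Ioo (0 : ℝ) 1) :
    ContinuousOn (fun x => klBern x q) (Set.Ico 0 1) := by
  have hc : Continuous fun x : ℝ => x * Real.log x - x * Real.log q
      + ((1 - x) * Real.log (1 - x) - (1 - x) * Real.log (1 - q)) := by
    have h1 := Real.continuous_mul_log
    have h2 := h1.comp (continuous_const.sub continuous_id : Continuous fun x : ℝ => 1 - x)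
    simp only [Function.comp_def] at h2
    fun_prop
  refine hc.continuousOn.congr fun x hx => ?_
  have hq1 : 1 - q ≠ 0 := by linarith [hq.2]
  have hx2 : 1 - x ≠ 0 := by linarith [hx.2]
  simp only [klBern]
  rw [Real.log_div hx2 hq1]
  rcases hx.1.eq_or_lt with rfl | h
  · simp
  · rw [Real.log_div h.ne' hq.1.ne']
    ring

end KullbackLeibler

/-! ### Chernoff bounds for bounded variables -/

section Chernoff

/-- The average of the first `s` terms. -/
noncomputable def avg (x : ℕ → ℝ) (s : ℕ) : ℝ := (∑ j ∈ Finset.range s, x j) / s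

theorem avg_mem_Icc {x : ℕ → ℝ} (hx : ∀ j, x j ∈ Set.Icc (0 : ℝ) 1) (s : ℕ) :
    avg x s ∈ Set.Icc (0 : ℝ) 1 := by
  refine ⟨div_nonneg (Finset.sum_nonneg fun j _ => (hx j).1) (by positivity), ?_⟩
  refine div_le_one_of_le₀ ?_ (by positivity)
  calc ∑ j ∈ Finset.range s, x j ≤ ∑ j ∈ Finset.range s, (1 : ℝ) :=
        Finset.sum_le_sum fun j _ => (hx j).2
    _ = s := by simp

variable {Ω : Type*} [MeasurableSpace Ω]

theorem measurable_avg {Y : ℕ → Ω → ℝ} (hY : ∀ j, Measurable (Y j)) (s : ℕ) :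
    Measurable fun ω => avg (fun j => Y j ω) s := by
  unfold avg
  fun_prop

/-- A sequence of independent `[0, 1]`-valued random variables with mean `μ`. -/
structure IndepUnitSeq (P : Measure Ω) (μ : ℝ) (Y : ℕ → Ω → ℝ) : Prop where
  meas : ∀ j, Measurable (Y j)
  mem : ∀ j ω, Y j ω ∈ Set.Icc (0 : ℝ) 1
  indep : iIndepFun Y P
  mean : ∀ j, ∫ ω, Y j ω ∂P = μ

variable {P : Measure Ω} [IsProbabilityMeasure P] {μ : ℝ} {Y : ℕ → Ω → ℝ}

theorem IndepUnitSeq.integrable (h : IndepUnitSeq P μ Y) (j : ℕ) : Integrable (Y j) P :=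
  .of_bound (h.meas j).aestronglyMeasurable 1 <| .of_forall fun ω => by
    rw [Real.norm_eq_abs, abs_le]; constructor <;> linarith [(h.mem j ω).1, (h.mem j ω).2]

theorem IndepUnitSeq.one_sub (h : IndepUnitSeq P μ Y) :
    IndepUnitSeq P (1 - μ) fun j ω => 1 - Y j ω where
  meas j := measurable_const.sub (h.meas j)
  mem j ω := ⟨by linarith [(h.mem j ω).2], by linarith [(h.mem j ω).1]⟩
  indep := h.indep.comp (fun _ x => 1 - x) fun _ => measurable_const.sub measurable_id
  mean j := by
    rw [integral_sub (integrable_const _) (h.integrable j), h.mean]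
    simp

/-- Markov's inequality for a product of Bernoulli likelihood ratios of `q` against `μ`,
interpolated geometrically to `[0, 1]`. The parameter `q` is separate from `z` so that `z = 0` can
be reached as a limit. -/
theorem IndepUnitSeq.measureReal_avg_le_exp_tilt (h : IndepUnitSeq P μ Y) (hμ : μ < 1) {q : ℝ}
    (hq0 : 0 < q) (hqμ : q ≤ μ) (n : ℕ) (z : ℝ) :
    P.real {ω | avg (fun j => Y j ω) n ≤ z}
      ≤ Real.exp (-(n * (z * Real.log (q / μ) + (1 - z) * Real.log ((1 - q) / (1 - μ))))) := by
  have hμ0 := hq0.trans_le hqμ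
  set a := Real.log (q / μ) with ha
  set b := Real.log ((1 - q) / (1 - μ)) with hb
  have ha0 : a ≤ 0 := Real.log_nonpos (by positivity) (div_le_one_of_le₀ hqμ hμ0.le)
  have hb0 : 0 ≤ b := Real.log_nonneg ((one_le_div (by linarith)).2 (by linarith))
  let H : ℝ → ℝ := fun x => Real.exp (x * a + (1 - x) * b)
  -- By convexity of `exp`, `H` lies below its chord on `[0, 1]`, and the chord has expectation one.
  have Hc : Continuous H := by fun_prop
  have hle : ∀ x ∈ Set.Icc (0 : ℝ) 1, H x ≤ x * (q / μ) + (1 - x) * ((1 - q) / (1 - μ)) := by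
    intro x hx
    have := convexOn_exp.2 (Set.mem_univ a) (Set.mem_univ b) hx.1
      (by linarith [hx.2] : (0 : ℝ) ≤ 1 - x) (by ring)
    simpa [H, ha, hb, Real.exp_log (div_pos hq0 hμ0),
      Real.exp_log (div_pos (by linarith : (0 : ℝ) < 1 - q) (by linarith : (0 : ℝ) < 1 - μ))]
      using this
  have hE : ∀ j, ∫ ω, H (Y j ω) ∂P ≤ 1 := by
    intro j
    have hi := h.integrable j
    calc ∫ ω, H (Y j ω) ∂P
        ≤ ∫ ω, (Y j ω * (q / μ) + (1 - Y j ω) * ((1 - q) / (1 - μ))) ∂P := by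
          refine integral_mono_of_nonneg (.of_forall fun ω => (Real.exp_pos _).le)
            ((hi.mul_const _).add (((integrable_const _).sub hi).mul_const _))
            (.of_forall fun ω => hle _ (h.mem j ω))
      _ = 1 := by
          have hi' : Integrable (fun ω => 1 - Y j ω) P := (integrable_const _).sub hi
          rw [integral_add (hi.mul_const _) (hi'.mul_const _),
            integral_mul_const, integral_mul_const, integral_sub (integrable_const _) hi, h.mean]
          have : (1 : ℝ) - μ ≠ 0 := by linarith
          simp
          field_simp
          ring
  have hprod : ∫ ω, ∏ i : Fin n, H (Y i ω) ∂P ≤ 1 := by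
    have hI : iIndepFun (fun i : Fin n => Y i) P := h.indep.precomp Fin.val_injective
    rw [hI.integral_fun_prod_comp (f := fun _ => H) (fun i => (h.meas i).aemeasurable)
      fun _ => Hc.aestronglyMeasurable]
    exact Finset.prod_le_one (fun i _ => integral_nonneg fun ω => (Real.exp_pos _).le)
      fun i _ => hE i
  have hprod_eq : ∀ ω, ∏ i : Fin n, H (Y i ω)
      = Real.exp (n * (avg (fun j => Y j ω) n * a + (1 - avg (fun j => Y j ω) n) * b)) := by
    intro ω
    simp only [H, ← Real.exp_sum]
    congr 1
    rw [Finset.sum_add_distrib, ← Finset.sum_mul, ← Finset.sum_mul, Finset.sum_sub_distrib,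
      Fin.sum_univ_eq_sum_range (fun j => Y j ω)]
    rcases Nat.eq_zero_or_pos n with rfl | hn
    · simp
    · have : (n : ℝ) ≠ 0 := by positivity
      simp [avg]
      field_simp
  have hint : Integrable (fun ω => ∏ i : Fin n, H (Y i ω)) P := by
    refine .of_bound (Measurable.aestronglyMeasurable ?_) (Real.exp (n * b)) (.of_forall fun ω => ?_)
    · exact Finset.measurable_fun_prod _ fun i _ => Hc.measurable.comp (h.meas i)
    · rw [hprod_eq, Real.norm_eq_abs, Real.abs_exp]
      have := avg_mem_Icc (fun j => h.mem j ω) n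
      gcongr
      nlinarith [this.1, this.2, mul_nonneg this.1 hb0, mul_nonneg this.1 (neg_nonneg.2 ha0)]
  set c := (n : ℝ) * (z * a + (1 - z) * b) with hc
  have hmarkov := mul_meas_ge_le_integral_of_nonneg (μ := P)
    (.of_forall fun ω => Finset.prod_nonneg fun i _ => (Real.exp_pos _).le) hint (Real.exp c)
  have hsub : P.real {ω | avg (fun j => Y j ω) n ≤ z}
      ≤ P.real {ω | Real.exp c ≤ ∏ i : Fin n, H (Y i ω)} := by
    refine measureReal_mono fun ω hω => ?_
    simp only [Set.mem_ofPred_eq] at hω ⊢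
    rw [hprod_eq, hc]
    gcongr Real.exp ((n : ℝ) * ?_)
    -- As `a ≤ 0 ≤ b`, the exponent decreases in the average.
    nlinarith
  rw [Real.exp_neg, ← one_div, le_div_iff₀ (Real.exp_pos _), mul_comm]
  exact (mul_le_mul_of_nonneg_left hsub (Real.exp_pos _).le).trans (hmarkov.trans hprod)

theorem IndepUnitSeq.measureReal_avg_le (h : IndepUnitSeq P μ Y) (hμ : μ < 1) {z : ℝ}
    (hz0 : 0 ≤ z) (hzμ : z < μ) (n : ℕ) :
    P.real {ω | avg (fun j => Y j ω) n ≤ z} ≤ Real.exp (-(n * klBern z μ)) := by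
  rcases hz0.eq_or_lt with rfl | hz
  · have ht : Tendsto (fun q : ℝ => Real.exp (-(n * (0 * Real.log (q / μ)
        + (1 - 0) * Real.log ((1 - q) / (1 - μ)))))) (𝓝[>] 0)
        (𝓝 (Real.exp (-(n * klBern 0 μ)))) := by
      have : ContinuousAt (fun q : ℝ => Real.exp (-(n * (1 * Real.log ((1 - q) / (1 - μ)))))) 0 := by
        have h1 : (1 - (0 : ℝ)) / (1 - μ) ≠ 0 :=
          div_ne_zero (by norm_num) (by linarith)
        fun_prop (disch := assumption)
      simpa [klBern] using this.tendsto.mono_left nhdsWithin_le_nhds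
    refine ge_of_tendsto ht ?_
    filter_upwards [Ioo_mem_nhdsGT hzμ] with q hq
    exact h.measureReal_avg_le_exp_tilt hμ hq.1 hq.2.le n 0
  · exact h.measureReal_avg_le_exp_tilt hμ hz hzμ.le n z

/-- The admissible averages form a compact set. With `z` its largest element, the event forces the
average to be at most `z`, and `klBern_add_le` splits the exponent. The additional `klBern y μ` is
what later gives summability over the number of samples. -/
theorem IndepUnitSeq.measureReal_klBern_le (h : IndepUnitSeq P μ Y) (hμ : μ < 1) {y : ℝ}
    (hy0 : 0 < y) (hyμ : y < μ) (n : ℕ) (a : ℝ) :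
    P.real {ω | avg (fun j => Y j ω) n ≤ y ∧ a ≤ klBern (avg (fun j => Y j ω) n) y}
      ≤ Real.exp (-(n * (a + klBern y μ))) := by
  have hy1 := hyμ.trans hμ
  let A : Set ℝ := Set.Icc 0 y ∩ (fun x => klBern x y) ⁻¹' Set.Ici a
  have hcont : ContinuousOn (fun x => klBern x y) (Set.Icc 0 y) :=
    (continuousOn_klBern_left ⟨hy0, hy1⟩).mono fun x hx => ⟨hx.1, hx.2.trans_lt hy1⟩
  have hA : IsCompact A :=
    isCompact_Icc.of_isClosed_subset (hcont.preimage_isClosed_of_isClosed isClosed_Icc isClosed_Ici)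
      Set.inter_subset_left
  have hmem : ∀ ω, avg (fun j => Y j ω) n ≤ y ∧ a ≤ klBern (avg (fun j => Y j ω) n) y →
      avg (fun j => Y j ω) n ∈ A := fun ω hω =>
    ⟨⟨(avg_mem_Icc (fun j => h.mem j ω) n).1, hω.1⟩, hω.2⟩
  rcases A.eq_empty_or_nonempty with hA0 | hA0
  · have : {ω | avg (fun j => Y j ω) n ≤ y ∧ a ≤ klBern (avg (fun j => Y j ω) n) y} = ∅ :=
      Set.eq_empty_of_forall_notMem fun ω hω => by simpa [hA0] using hmem ω hω
    rw [this]
    simpa using (Real.exp_pos _).le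
  · obtain ⟨z, hz⟩ := hA.exists_isGreatest hA0
    have hz0 : 0 ≤ z := hz.1.1.1
    have hzy : z ≤ y := hz.1.1.2
    calc _ ≤ P.real {ω | avg (fun j => Y j ω) n ≤ z} :=
          measureReal_mono fun ω hω => hz.2 (hmem ω hω)
      _ ≤ Real.exp (-(n * klBern z μ)) := h.measureReal_avg_le hμ hz0 (hzy.trans_lt hyμ) n
      _ ≤ _ := by
          gcongr
          have h1 : a ≤ klBern z y := hz.1.2
          linarith [klBern_add_le hz0 hzy hy0 hyμ.le hμ]

/-- The reflection `1 - Y` turns the upper tail into a lower tail. -/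
theorem IndepUnitSeq.exists_measureReal_le_avg (h : IndepUnitSeq P μ Y) (hμ0 : 0 < μ) {y : ℝ}
    (hμy : μ < y) (hy1 : y < 1) :
    ∃ c > 0, ∀ n : ℕ, 1 ≤ n →
      P.real {ω | y ≤ avg (fun j => Y j ω) n} ≤ Real.exp (-(n * c)) := by
  refine ⟨klBern (1 - y) (1 - μ), klBern_pos (by linarith) (by linarith)
    ⟨by linarith, by linarith⟩ (by intro h; linarith), fun n hn => ?_⟩
  refine le_trans (measureReal_mono fun ω hω => ?_)
    (h.one_sub.measureReal_avg_le (by linarith) (by linarith : 0 ≤ 1 - y) (by linarith) n)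
  have : (n : ℝ) ≠ 0 := by positivity
  simp only [Set.mem_ofPred_eq, avg, Finset.sum_sub_distrib] at hω ⊢
  rw [sub_div]
  simp only [Finset.sum_const, Finset.card_range, nsmul_eq_mul, mul_one, div_self this]
  linarith

end Chernoff

/-! ### Packet lengths and delay -/

section Schedule

theorem tau_zero : tau 0 = 0 := by simp [tau]

theorem tau_one : tau 1 = 1 := by
  have : Nat.clog 2 2 = 1 := by norm_num [Nat.clog]
  simp [tau, this]

theorem tau_succ (i : ℕ) : tau (i + 1) = tau i + Nat.clog 2 (i + 2) := by
  rcases Nat.eq_zero_or_pos i with rfl | hi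
  · have : Nat.clog 2 2 = 1 := by norm_num [Nat.clog]
    simp [tau_zero, tau_one, this]
  have h1 : 1 ≤ tau i := le_trans hi (le_tau i)
  have h2 : 1 ≤ tau (i + 1) := (by omega : 1 ≤ i + 1).trans (le_tau (i + 1))
  have hmono : Nat.clog 2 (i + 1) ≤ Nat.clog 2 (i + 2) := Nat.clog_mono_right 2 (by omega)
  have hle : i + 1 ≤ 2 ^ Nat.clog 2 (i + 1) := Nat.le_pow_clog (by norm_num) _
  have hlt : 2 ^ (Nat.clog 2 (i + 2)).pred < i + 2 :=
    Nat.pow_pred_clog_lt_self (by norm_num) (by omega)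
  unfold tau at *
  rcases hmono.eq_or_lt with h | h
  · rw [show i + 1 + 1 = i + 2 from rfl, ← h] at *
    have : (i + 2) * Nat.clog 2 (i + 1) = (i + 1) * Nat.clog 2 (i + 1) + Nat.clog 2 (i + 1) := by
      ring
    omega
  -- The rounded-up logarithm jumps only when `i + 1` is a power of two, and then by one.
  · generalize Nat.clog 2 (i + 1) = c at *
    rw [show i + 1 + 1 = i + 2 from rfl] at *
    generalize Nat.clog 2 (i + 2) = d at *
    have hcd : 2 ^ c ≤ 2 ^ d.pred := Nat.pow_le_pow_right (by norm_num) (Nat.le_pred_of_lt h)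
    have hd : d.pred = c := by
      refine le_antisymm ((Nat.pow_le_pow_iff_right (a := 2) (by norm_num)).1 ?_)
        (Nat.le_pred_of_lt h)
      omega
    obtain rfl : d = c + 1 := by have := Nat.succ_pred_eq_of_pos (show 0 < d by omega); omega
    have e1 : (i + 2) * (c + 1) = (i + 1) * c + c + i + 2 := by ring
    have e2 : 2 ^ (c + 1) = 2 * 2 ^ c := by ring
    have e3 : 2 ^ c = i + 1 := by
      rw [hd] at hlt
      omega
    omega

theorem tau_strictMono : StrictMono tau := strictMono_nat_of_lt_succ fun i => by
  rw [tau_succ]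
  have : 0 < Nat.clog 2 (i + 2) := Nat.clog_pos (by norm_num) (by omega)
  omega

theorem tau_iota_le (s : ℕ) : tau (iota s) ≤ s := (iota_isGreatest s).1

theorem lt_tau_iota_succ (s : ℕ) : s < tau (iota s + 1) := by
  by_contra! h
  have := (iota_isGreatest s).2 h
  omega

theorem iota_eq {s i : ℕ} (h1 : tau i ≤ s) (h2 : s < tau (i + 1)) : iota s = i := by
  refine le_antisymm ?_ ((iota_isGreatest s).2 h1)
  have := tau_strictMono.lt_iff_lt.1 ((tau_iota_le s).trans_lt h2)
  omega

theorem one_le_iota {s : ℕ} (hs : 1 ≤ s) : 1 ≤ iota s :=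
  (iota_isGreatest s).2 (by rw [Set.mem_ofPred_eq, tau_one]; exact hs)

theorem iota_mono : Monotone iota := fun s _ h =>
  (iota_isGreatest _).2 ((tau_iota_le s).trans h)

theorem tendsto_iota : Tendsto iota atTop atTop :=
  tendsto_atTop_mono' _ (f₁ := fun s => iota s) .rfl <|
    tendsto_atTop_atTop_of_monotone iota_mono fun i =>
      ⟨tau i, (iota_isGreatest _).2 (le_refl (tau i))⟩

theorem one_le_eta (s : ℕ) : 1 ≤ eta s := by unfold eta; omega

/-- The number of bits of the most recent complete packet. -/
def packetLength (s : ℕ) : ℕ := tau (iota s) - tau (iota s - 1)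

theorem packetLength_eq {s : ℕ} (hs : 1 ≤ s) : packetLength s = Nat.clog 2 (iota s + 1) := by
  obtain ⟨i, hi⟩ : ∃ i, iota s = i + 1 := ⟨iota s - 1, by have := one_le_iota hs; omega⟩
  rw [packetLength, hi, Nat.add_sub_cancel, tau_succ, Nat.add_sub_cancel_left]

theorem tendsto_packetLength : Tendsto packetLength atTop atTop := by
  have h : Tendsto (fun n => Nat.clog 2 (n + 1)) atTop atTop :=
    tendsto_atTop_atTop_of_monotone (fun a b hab => Nat.clog_mono_right 2 (by omega)) fun b =>
      ⟨2 ^ b, by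
        calc b = Nat.clog 2 (2 ^ b) := (Nat.clog_pow 2 b (by norm_num)).symm
          _ ≤ _ := Nat.clog_mono_right 2 (by omega)⟩
  refine (h.comp tendsto_iota).congr' ?_
  filter_upwards [eventually_ge_atTop 1] with s hs
  rw [packetLength_eq hs]
  rfl

/-- Since the samples of the latest complete packet were fixed, only that packet and the unfinished
next one have been in transit, each of logarithmic length. -/
theorem le_eta_add_clog {s : ℕ} (hs : 1 ≤ s) : s ≤ eta s + 2 * Nat.clog 2 (eta s + 2) := by
  obtain ⟨i, hi⟩ : ∃ i, iota s = i + 1 := ⟨iota s - 1, by have := one_le_iota hs; omega⟩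
  have h1 := lt_tau_iota_succ s
  rw [hi, tau_succ, tau_succ] at h1
  have he : eta s = 1 + tau i := by rw [eta, hi, Nat.add_sub_cancel]
  have h2 := le_tau i
  have h3 : Nat.clog 2 (i + 2) ≤ Nat.clog 2 (eta s + 2) := Nat.clog_mono_right 2 (by omega)
  have h4 : Nat.clog 2 (i + 1 + 2) ≤ Nat.clog 2 (eta s + 2) := Nat.clog_mono_right 2 (by omega)
  omega

theorem exists_clog_le {ε : ℝ} (hε : 0 < ε) :
    ∃ C : ℝ, 0 ≤ C ∧ ∀ n : ℕ, (Nat.clog 2 (n + 2) : ℝ) ≤ ε * n + C := by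
  have h : Tendsto (fun c : ℕ => (c : ℝ) ^ 1 / 2 ^ c) atTop (𝓝 0) :=
    tendsto_pow_const_div_const_pow_of_one_lt 1 one_lt_two
  obtain ⟨c₀, hc₀⟩ := eventually_atTop.1 (h.eventually (ge_mem_nhds (show 0 < ε / 2 by positivity)))
  -- A logarithm below `c₀` is covered by the constant. Otherwise it is at most `ε / 2` times its
  -- power of two, which is less than `2 (n + 2)`; hence the `2 * ε`.
  refine ⟨c₀ + 2 * ε, by positivity, fun n => ?_⟩
  have hlt : 2 ^ (Nat.clog 2 (n + 2)).pred < n + 2 :=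
    Nat.pow_pred_clog_lt_self (by norm_num) (by omega)
  have hpos : 0 < Nat.clog 2 (n + 2) := Nat.clog_pos (by norm_num) (by omega)
  obtain ⟨d, hd⟩ : ∃ d, Nat.clog 2 (n + 2) = d + 1 := ⟨_, (Nat.succ_pred_eq_of_pos hpos).symm⟩
  rw [hd] at hlt ⊢
  have hlt' : (2 : ℝ) ^ d < n + 2 := by exact_mod_cast hlt
  rcases le_total c₀ (d + 1) with h1 | h1
  · have := hc₀ _ h1
    rw [pow_one, div_le_iff₀ (by positivity), pow_succ] at this
    have hc : (0 : ℝ) ≤ c₀ := by positivity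
    nlinarith
  · have : ((d + 1 : ℕ) : ℝ) ≤ c₀ := by exact_mod_cast h1
    have h2 : 0 ≤ ε * n := by positivity
    linarith

/-- The number of pulls exceeds the number of samples behind the estimate by a sublinear amount. -/
theorem exists_le_eta {ε : ℝ} (hε : 0 < ε) :
    ∃ C : ℝ, 0 ≤ C ∧ ∀ s : ℕ, 1 ≤ s → (s : ℝ) ≤ (1 + ε) * eta s + C := by
  obtain ⟨C, hC0, hC⟩ := exists_clog_le (half_pos hε)
  refine ⟨2 * C, by positivity, fun s hs => ?_⟩
  have h1 : (s : ℝ) ≤ eta s + 2 * Nat.clog 2 (eta s + 2) := by exact_mod_cast le_eta_add_clog hs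
  linarith [hC (eta s)]

/-- As `s ≤ 2 * eta s + C` for `s ≥ 1`, a geometric series dominates. -/
theorem summable_exp_eta {c : ℝ} (hc : 0 < c) :
    Summable fun s : ℕ => Real.exp (-(eta s * c)) := by
  obtain ⟨C, -, hC⟩ := exists_le_eta one_pos
  have hg : Summable fun s : ℕ => Real.exp (C * c / 2) * Real.exp ((s : ℝ) * (-c / 2)) :=
    (Real.summable_exp_nat_mul_iff.2 (by linarith)).mul_left _
  refine (summable_nat_add_iff 1).1 (Summable.of_nonneg_of_le (fun s => (Real.exp_pos _).le)
    (fun s => ?_) ((summable_nat_add_iff 1).2 hg))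
  rw [← Real.exp_add]
  gcongr
  have := hC (s + 1) (by omega)
  nlinarith

end Schedule

/-! ### Dyadic rounding -/

section Quantizer

/-- The upper end of the dyadic interval of length `2 ^ (-a)` that contains `x`. -/
noncomputable def quantize (a : ℕ) (x : ℝ) : ℝ := (Gam a x + 1) / 2 ^ a

/-- Rounding is upward, so an estimate is never less optimistic than the average behind it. -/
theorem le_quantize (a : ℕ) (x : ℝ) : x ≤ quantize a x := by
  rw [quantize, le_div_iff₀ (by positivity), mul_comm]
  unfold Gam
  split_ifs with h
  · simp [h]
  · simpa using Int.le_ceil ((2 : ℝ) ^ a * x)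

theorem quantize_le (a : ℕ) (x : ℝ) : quantize a x ≤ x + 1 / 2 ^ a := by
  rw [quantize, div_le_iff₀ (by positivity), add_mul, div_mul_cancel₀ _ (by positivity), mul_comm]
  unfold Gam
  split_ifs with h
  · simp [h]
  · simpa using (Int.ceil_lt_add_one ((2 : ℝ) ^ a * x)).le

theorem quantize_mem_Icc (a : ℕ) {x : ℝ} (hx : x ∈ Set.Icc (0 : ℝ) 1) :
    quantize a x ∈ Set.Icc (0 : ℝ) 1 := by
  refine ⟨hx.1.trans (le_quantize a x), ?_⟩
  rw [quantize]
  refine div_le_one_of_le₀ ?_ (by positivity)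
  unfold Gam
  split_ifs with h
  · simpa using one_le_pow₀ (M₀ := ℝ) one_le_two
  · have : ⌈(2 : ℝ) ^ a * x⌉ ≤ (2 : ℤ) ^ a := Int.ceil_le.2 (by
      push_cast
      exact mul_le_of_le_one_right (by positivity) hx.2)
    have : (⌈(2 : ℝ) ^ a * x⌉ : ℝ) ≤ (2 : ℝ) ^ a := by exact_mod_cast this
    simpa using this

theorem Gam_zero_of_mem {x : ℝ} (hx : x ∈ Set.Icc (0 : ℝ) 1) : Gam 0 x = 0 := by
  unfold Gam
  split_ifs with h
  · rfl
  · have : ⌈x⌉ = 1 := Int.ceil_eq_iff.2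
      ⟨by simpa using lt_of_le_of_ne hx.1 (Ne.symm h), by simpa using hx.2⟩
    simp [this]

/-- The sum telescopes: the term for `j` is `Gam (j + 1) x / 2 ^ (j + 1) - Gam j x / 2 ^ j`, and
`Gam 0 x = 0` on the unit interval. -/
theorem sum_bits_eq (a : ℕ) {x : ℝ} (hx : x ∈ Set.Icc (0 : ℝ) 1) :
    ∑ j ∈ Finset.range a, ((2 : ℝ) ^ (j + 1))⁻¹ * ((Gam (j + 1) x - 2 * Gam j x : ℤ) : ℝ)
      = Gam a x / 2 ^ a := by
  induction a with
  | zero => simp [Gam_zero_of_mem hx]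
  | succ a ih =>
    rw [Finset.sum_range_succ, ih]
    push_cast
    field_simp
    ring

theorem measurable_quantize (a : ℕ) : Measurable (quantize a) := by
  have : Measurable (Gam a) := by
    unfold Gam
    refine Measurable.ite (measurableSet_singleton (0 : ℝ)) measurable_const ?_
    exact (Int.measurable_ceil.comp (measurable_const.mul measurable_id)).sub measurable_const
  unfold quantize
  exact (((measurable_of_countable ((↑) : ℤ → ℝ)).comp this).add_const 1).div_const _

end Quantizer

/-! ### The decoded estimate -/

section Decoding

/-- The bit sent after the last of the rewards `r`. -/
noncomputable def bit (r : List ℝ) : Bool := decide (messageValue r = 1)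

theorem messagePolicy_eq : messagePolicy = fun _ => bit := rfl

theorem bit_eq {r : List ℝ} (hr : r ≠ []) :
    (if bit r then (1 : ℝ) else 0) = messageValue r := by
  rcases messageValue_eq_zero_or_one r hr with h | h <;> simp [bit, h]

theorem sum_take_map_range (x : ℕ → ℝ) {p s : ℕ} (h : p ≤ s) :
    (((List.range s).map x).take p).sum = ∑ j ∈ Finset.range p, x j := by
  rw [← List.map_take, List.take_range, min_eq_left h, ← List.sum_toFinset _ List.nodup_range]
  simp [List.toFinset_range]

/-- The leader's estimate of the mean of an arm, as a function of the rewards of this arm. -/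
noncomputable def estimate (x : ℕ → ℝ) (s : ℕ) : ℝ := quantize (packetLength s) (avg x (eta s))

/-- Throughout one packet `iota` of the previous pull count is constant, so all its bits describe
the same average. -/
theorem messageValue_range (x : ℕ → ℝ) {i j : ℕ} (hj : tau i + j < tau (i + 1)) :
    messageValue ((List.range (tau i + j + 1)).map x)
      = Gam (j + 1) (avg x (1 + tau i)) - 2 * Gam j (avg x (1 + tau i)) := by
  have hi : iota (tau i + j) = i := iota_eq (by omega) hj
  simp only [messageValue, List.length_map, List.length_range, Nat.add_sub_cancel, hi]
  rw [sum_take_map_range x (by omega), avg, show tau i + j + 1 - tau i = j + 1 by omega,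
    Nat.add_sub_cancel]

/-- The bits telescope by `sum_bits_eq`; the final power of two in `decode` is the `+ 1` in
`quantize`. -/
theorem decode_sent {x : ℕ → ℝ} (hx : ∀ j, x j ∈ Set.Icc (0 : ℝ) 1) {s : ℕ} (hs : 1 ≤ s) :
    decode (sent bit x s) = estimate x s := by
  obtain ⟨i, hi⟩ : ∃ i, iota s = i + 1 := ⟨iota s - 1, by have := one_le_iota hs; omega⟩
  have hle : tau (i + 1) ≤ s := hi ▸ tau_iota_le s
  obtain ⟨a, ha⟩ : ∃ a, tau (i + 1) = tau i + a :=
    ⟨_, (Nat.add_sub_cancel' (tau_strictMono i.lt_succ_self).le).symm⟩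
  have hsum := sum_bits_eq a (avg_mem_Icc hx (1 + tau i))
  simp only [decode, estimate, quantize, eta, packetLength, length_sent, hi, Nat.add_sub_cancel]
  rw [ha, Nat.add_sub_cancel_left, add_div, ← hsum]
  congr 1
  · rw [show 1 + tau i = 0 + (tau i + 1) by ring, ← Finset.Ico_add_one_right_eq_Icc,
      show tau i + a + 1 = a + (tau i + 1) by ring, ← Finset.sum_Ico_add', Finset.range_eq_Ico]
    refine Finset.sum_congr rfl fun j hj => ?_
    have hj : j < a := (Finset.mem_Ico.1 hj).2
    rw [show j + (tau i + 1) - 1 = tau i + j by omega, sent,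
      List.getD_eq_getElem _ _ (by simp; omega)]
    simp only [List.getElem_map, List.getElem_range]
    rw [bit_eq (by simp), messageValue_range x (by omega)]
    congr 1
    · rw [← zpow_natCast, ← zpow_neg]
      congr 1
      push_cast
      ring
    · rw [zero_add, add_comm (tau i) 1]
  · rw [one_div, ← zpow_natCast, ← zpow_neg]
    congr 1
    push_cast
    ring

theorem estimate_mem_Icc {x : ℕ → ℝ} (hx : ∀ j, x j ∈ Set.Icc (0 : ℝ) 1) (s : ℕ) :
    estimate x s ∈ Set.Icc (0 : ℝ) 1 := quantize_mem_Icc _ (avg_mem_Icc hx _)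

theorem avg_le_estimate (x : ℕ → ℝ) (s : ℕ) : avg x (eta s) ≤ estimate x s := le_quantize _ _

/-- The rounding error is at most `2 ^ (-packetLength s)`, uniformly in the rewards. -/
theorem exists_estimate_le {ε : ℝ} (hε : 0 < ε) :
    ∃ s₀, ∀ s ≥ s₀, ∀ x : ℕ → ℝ, estimate x s ≤ avg x (eta s) + ε := by
  have h : Tendsto (fun s => ((1 : ℝ) / 2) ^ packetLength s) atTop (𝓝 0) :=
    (tendsto_pow_atTop_nhds_zero_of_lt_one (by norm_num) (by norm_num)).comp tendsto_packetLength
  obtain ⟨s₀, hs₀⟩ := eventually_atTop.1 (h.eventually (ge_mem_nhds hε))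
  refine ⟨s₀, fun s hs x => (quantize_le _ _).trans ?_⟩
  have := hs₀ s hs
  rw [one_div_pow] at this
  linarith

end Decoding

/-! ### The exploration function -/

section Explore

theorem explore_mono : Monotone explore := monotone_nat_of_le_succ fun t => by
  rcases Nat.eq_zero_or_pos t with rfl | ht
  · simp [explore]
  · have h1 : (1 : ℝ) ≤ t := by exact_mod_cast ht
    have h2 : 0 ≤ Real.log t := Real.log_nonneg h1
    unfold explore
    push_cast
    gcongr <;> linarith

theorem one_le_explore (t : ℕ) : 1 ≤ explore t := by
  unfold explore
  have : 0 ≤ (t : ℝ) * Real.log t ^ 2 := by positivity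
  linarith

/-- Cauchy condensation: `2 ^ k / explore (2 ^ k)` is at most `1 / (k log 2) ^ 2` for `k ≥ 1`. -/
theorem summable_inv_explore : Summable fun t => (explore t)⁻¹ := by
  have hpos : ∀ t, 0 < explore t := fun t => one_pos.trans_le (one_le_explore t)
  refine (summable_condensed_iff_of_nonneg (fun t => (inv_pos.2 (hpos t)).le)
    fun m n _ hmn => inv_anti₀ (hpos m) (explore_mono hmn)).1 ?_
  have hs : Summable fun k : ℕ => (Real.log 2 ^ 2)⁻¹ * (((k + 1 : ℕ) : ℝ) ^ 2)⁻¹ :=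
    ((summable_nat_add_iff (f := fun k : ℕ => ((k : ℝ) ^ 2)⁻¹) 1).2
      (Real.summable_nat_pow_inv.2 (by norm_num))).mul_left _
  refine (summable_nat_add_iff 1).1 (Summable.of_nonneg_of_le
    (fun k => mul_nonneg (by positivity) (inv_pos.2 (hpos _)).le) (fun k => ?_) hs)
  have hl : 0 < Real.log 2 := Real.log_pos one_lt_two
  rw [← mul_inv, ← div_eq_mul_inv, div_le_iff₀ (hpos _), ← div_eq_inv_mul,
    le_div_iff₀ (by positivity), explore]
  push_cast
  rw [Real.log_pow]
  push_cast
  have : 0 < (2 : ℝ) ^ (k + 1) := by positivity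
  nlinarith

theorem tendsto_log_explore : Tendsto (fun t => Real.log (explore t)) atTop atTop := by
  refine Real.tendsto_log_atTop.comp (tendsto_atTop_mono' _ ?_
    (tendsto_natCast_atTop_atTop (R := ℝ)))
  filter_upwards [(Real.tendsto_log_atTop.comp
    (tendsto_natCast_atTop_atTop (R := ℝ))).eventually_ge_atTop 1] with t ht
  have h1 : (1 : ℝ) ≤ Real.log t := ht
  have h2 : (0 : ℝ) ≤ t := by positivity
  unfold explore
  nlinarith [mul_le_mul_of_nonneg_left (one_le_pow₀ h1 (n := 2)) h2]

end Explore

/-! ### Consequences of the assumptions on the decision functions -/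

section DecisionFunction

variable {g : ℕ → ℝ → ℕ → ℝ} {x₁ x₂ : ℝ} {t s : ℕ}

theorem one_le_pullsBelow (hg : ConvergesToAverage g) (ht : 1 ≤ t) (h0 : 0 < x₁) (h12 : x₁ < x₂)
    (h1 : x₂ < 1) : 1 ≤ pullsBelow g t x₁ x₂ :=
  (Nat.sInf_mem (exists_pulls hg ht h0 h12 h1)).1

theorem le_of_pullsBelow_le (hg₁ : Monotonicity g) (hg₂ : ConvergesToAverage g) (ht : 1 ≤ t)
    (h0 : 0 < x₁) (h12 : x₁ < x₂) (h1 : x₂ < 1) (hs : pullsBelow g t x₁ x₂ ≤ s) :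
    g t x₁ s ≤ x₂ :=
  have h := Nat.sInf_mem (exists_pulls hg₂ ht h0 h12 h1)
  (hg₁.pulls x₁ ⟨h0.le, (h12.trans h1).le⟩ _ s t h.1 hs ht).trans h.2

theorem lt_of_lt_pullsBelow (h1 : 1 ≤ s) (hs : s < pullsBelow g t x₁ x₂) : x₂ < g t x₁ s := by
  by_contra! h
  exact Nat.notMem_of_lt_sInf hs ⟨h1, h⟩

theorem log_explore_div_le_klBern (hg₃ : SufficientlyAbove g) (ht : 2 ≤ t) (hs : 1 ≤ s)
    {x y : ℝ} (hx0 : 0 ≤ x) (hx1 : x < 1) (hy : y < 1) (h : g t x s ≤ y) :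
    x < y ∧ Real.log (explore t) / s ≤ klBern x y := by
  obtain ⟨h1, h2⟩ := hg₃ x ⟨hx0, hx1⟩ t s ht hs
  exact ⟨h1.trans_le h, (h2 (h.trans_lt hy)).trans
    (klBern_mono_right hx0 h1.le (hx0.trans_lt h1) h hy)⟩

/-- `SufficientlyAbove` says nothing at average one, but monotonicity transfers the bound from
averages below. This matters since an estimate may be rounded up to one. -/
theorem le_index_one (hg₁ : Monotonicity g) (hg₃ : SufficientlyAbove g) (ht : 2 ≤ t)
    (hs : 1 ≤ s) : 1 ≤ g t 1 s := by
  refine le_of_forall_lt fun y hy => ?_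
  have hz0 : 0 ≤ max y 0 := le_max_right _ _
  have hz1 : max y 0 < 1 := max_lt hy one_pos
  calc y ≤ max y 0 := le_max_left _ _
    _ < g t (max y 0) s := (hg₃ _ ⟨hz0, hz1⟩ t s ht hs).1
    _ ≤ g t 1 s := hg₁.average _ ⟨hz0, hz1.le⟩ 1 ⟨zero_le_one, le_rfl⟩ s t hs (by omega) hz1.le

/-- At the threshold `s` the index is at most `x₂`, which forces `log (explore t) ≤ s * klBern x₁
x₂`. -/
theorem tendsto_pullsBelow (hg₂ : ConvergesToAverage g) (hg₃ : SufficientlyAbove g)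
    (h0 : 0 < x₁) (h12 : x₁ < x₂) (h1 : x₂ < 1) :
    Tendsto (fun t => (pullsBelow g t x₁ x₂ : ℝ)) atTop atTop := by
  have hd : 0 < klBern x₁ x₂ :=
    klBern_pos h0.le (h12.trans h1) ⟨h0.trans h12, h1⟩ h12.ne
  refine tendsto_atTop_mono' _ ?_ (tendsto_log_explore.atTop_div_const hd)
  filter_upwards [eventually_ge_atTop 2] with t ht
  have hS := Nat.sInf_mem (exists_pulls hg₂ (by omega : 1 ≤ t) h0 h12 h1)
  have := (log_explore_div_le_klBern hg₃ ht hS.1 h0.le (h12.trans h1) h1 hS.2).2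
  have hpos : (0 : ℝ) < sInf {s | 1 ≤ s ∧ g t x₁ s ≤ x₂} := by exact_mod_cast hS.1
  rw [div_le_iff₀ hpos] at this
  rw [div_le_iff₀ hd, mul_comm]
  exact this

/-- A decision function is measurable in the average, along averages in `[0, 1]`. -/
theorem measurable_decision (hg₁ : Monotonicity g) {Ω : Type*} [MeasurableSpace Ω] (ht : 1 ≤ t)
    (hs : 1 ≤ s) {Z : Ω → ℝ} (hZ : Measurable Z) (hZ' : ∀ ω, Z ω ∈ Set.Icc (0 : ℝ) 1) :
    Measurable fun ω => g t (Z ω) s := by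
  -- Monotonicity is known only on `[0, 1]`; projecting onto it gives a monotone, hence Borel,
  -- function on the line.
  have hm : Monotone fun x : ℝ => g t (Set.projIcc 0 1 zero_le_one x) s := fun x y hxy =>
    hg₁.average _ (Subtype.mem _) _ (Subtype.mem _) s t hs ht (Set.monotone_projIcc zero_le_one hxy)
  simpa [Function.comp_def, Set.projIcc_of_mem zero_le_one (hZ' _)] using hm.measurable.comp hZ

end DecisionFunction

/-! ### One-bit policy: charging the pulls of an arm -/

section OneBitPulls

variable {K : ℕ} (g : ℕ → ℝ → ℕ → ℝ) (tie : TieBreak K)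

/-- Compare indices with the level `y`. Either the best arm is at or below it, or the chosen arm is
above it, which requires few samples or a large estimate. -/
theorem pulls_oneBit_succ_cases (hg₁ : Monotonicity g) (hg₂ : ConvergesToAverage g)
    (hg₃ : SufficientlyAbove g) {x : Fin K → ℕ → ℝ}
    (hx : ∀ k j, x k j ∈ Set.Icc (0 : ℝ) 1) (hK : 1 ≤ K) (best k : Fin K) {v y : ℝ} (hv0 : 0 < v)
    (hvy : v < y) (hy1 : y < 1) {n t : ℕ} (htn : t < n) (htK : K ≤ t)
    (hA : armAt (oneBitPolicy g tie) messagePolicy x (t + 1) = k) :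
    (∃ s ∈ Finset.range n, avg (x best) (eta s) ≤ y ∧
      Real.log (explore (t + 1)) / eta s ≤ klBern (avg (x best) (eta s)) y) ∨
    (1 ≤ pulls (oneBitPolicy g tie) messagePolicy x t k ∧
      eta (pulls (oneBitPolicy g tie) messagePolicy x t k) < pullsBelow g n v y) ∨
    v < estimate (x k) (pulls (oneBitPolicy g tie) messagePolicy x t k) := by
  rw [messagePolicy_eq] at hA ⊢
  have hidx := index_le_index_armAt bit x tie (fun t m => g t (decode m) (eta m.length)) htK hA best
  have hpos : ∀ j, 1 ≤ pulls (oneBitPolicy g tie) (fun _ => bit) x t j := fun j =>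
    one_le_pulls (fun _ => bit) x tie _ htK j
  have hle : ∀ j, pulls (oneBitPolicy g tie) (fun _ => bit) x t j ≤ t := fun j => pulls_le _ _ _ t j
  change g (t + 1) (decode (sent bit (x best) (pulls (oneBitPolicy g tie) _ x t best)))
      (eta (sent bit (x best) (pulls (oneBitPolicy g tie) _ x t best)).length)
    ≤ g (t + 1) (decode (sent bit (x k) (pulls (oneBitPolicy g tie) _ x t k)))
      (eta (sent bit (x k) (pulls (oneBitPolicy g tie) _ x t k)).length) at hidx
  rw [decode_sent (hx best) (hpos best), decode_sent (hx k) (hpos k), length_sent, length_sent]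
    at hidx
  generalize pulls (oneBitPolicy g tie) (fun _ => bit) x t = N at *
  rcases le_or_gt (g (t + 1) (estimate (x best) (N best)) (eta (N best))) y with h | h
  · left
    refine ⟨N best, Finset.mem_range.2 ((hle best).trans_lt htn), ?_⟩
    have he := estimate_mem_Icc (hx best) (N best)
    have ha := avg_mem_Icc (hx best) (eta (N best))
    have hae := avg_le_estimate (x best) (N best)
    have he1 : estimate (x best) (N best) < 1 := by
      refine lt_of_le_of_ne he.2 fun e => ?_
      rw [e] at h
      linarith [le_index_one hg₁ hg₃ (show 2 ≤ t + 1 by omega) (one_le_eta (N best))]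
    obtain ⟨h1, h2⟩ := log_explore_div_le_klBern hg₃ (by omega) (one_le_eta _) he.1 he1 hy1 h
    -- The divergence to `y` only grows when the estimate is replaced by the smaller average, so
    -- rounding up is harmless here.
    exact ⟨hae.trans h1.le, h2.trans (klBern_anti_left ha.1 hae h1.le hy1)⟩
  · right
    rcases lt_or_ge v (estimate (x k) (N k)) with hv | hv
    · exact .inr hv
    · refine .inl ⟨hpos k, ?_⟩
      by_contra! hS
      have he := estimate_mem_Icc (hx k) (N k)
      have hv1 : v ∈ Set.Icc (0 : ℝ) 1 := ⟨hv0.le, (hvy.trans hy1).le⟩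
      have h1 := hg₁.average _ he v hv1 (eta (N k)) (t + 1) (one_le_eta _) (by omega) hv
      have h2 := hg₁.time v hv1 (eta (N k)) (t + 1) n (one_le_eta _) (by omega) htn
      have h3 := le_of_pullsBelow_le hg₁ hg₂ (by omega : 1 ≤ n) hv0 hvy hy1 hS
      linarith

open Classical in
-- Failures of the best arm are charged to the round, with a union over its unknown pull count. The
-- other two cases are charged to the current pull count of `k`, which takes each value at only one
-- pull.
theorem pulls_oneBit_le (hg₁ : Monotonicity g) (hg₂ : ConvergesToAverage g)
    (hg₃ : SufficientlyAbove g) {x : Fin K → ℕ → ℝ}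
    (hx : ∀ k j, x k j ∈ Set.Icc (0 : ℝ) 1) (hK : 1 ≤ K) (best k : Fin K) {v y : ℝ} (hv0 : 0 < v)
    (hvy : v < y) (hy1 : y < 1) (n : ℕ) :
    (pulls (oneBitPolicy g tie) messagePolicy x n k : ℝ) ≤ K
      + ∑ t ∈ Finset.range n, ∑ s ∈ Finset.range n,
          (if avg (x best) (eta s) ≤ y ∧
            Real.log (explore (t + 1)) / eta s ≤ klBern (avg (x best) (eta s)) y then 1 else 0)
      + ∑ s ∈ Finset.range n, ((if 1 ≤ s ∧ eta s < pullsBelow g n v y then 1 else 0)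
          + if v < estimate (x k) s then 1 else 0) := by
  set D : ℕ → ℕ → ℝ := fun t s => if avg (x best) (eta s) ≤ y ∧
    Real.log (explore (t + 1)) / eta s ≤ klBern (avg (x best) (eta s)) y then 1 else 0 with hD
  set ψ : ℕ → ℝ := fun s => (if 1 ≤ s ∧ eta s < pullsBelow g n v y then 1 else 0)
    + if v < estimate (x k) s then 1 else 0 with hψ
  have hD0 : ∀ t s, 0 ≤ D t s := fun t s => by simp only [hD]; split_ifs <;> norm_num
  have hψ0 : ∀ s, 0 ≤ ψ s := fun s => by simp only [hψ]; split_ifs <;> norm_num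
  set N := pulls (oneBitPolicy g tie) messagePolicy x with hN
  -- The last sum stops at the current pull count, so that each pull of `k` adds exactly one term.
  have key : ∀ t ≤ n, (N t k : ℝ) ≤ K
      + ∑ u ∈ Finset.range t, ∑ s ∈ Finset.range n, D u s + ∑ s ∈ Finset.range (N t k), ψ s := by
    intro t
    induction t with
    | zero => intro _; simp [hN, pulls_zero]
    | succ t ih =>
      intro htn
      rcases lt_or_ge t K with htK | htK
      · have h1 : N (t + 1) k ≤ K := (pulls_le _ _ _ _ _).trans htK
        have h1' : (N (t + 1) k : ℝ) ≤ K := by exact_mod_cast h1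
        have h2 : 0 ≤ ∑ u ∈ Finset.range (t + 1), ∑ s ∈ Finset.range n, D u s :=
          Finset.sum_nonneg fun _ _ => Finset.sum_nonneg fun _ _ => hD0 _ _
        have h3 : 0 ≤ ∑ s ∈ Finset.range (N (t + 1) k), ψ s := Finset.sum_nonneg fun _ _ => hψ0 _
        linarith
      · have h2 : 0 ≤ ∑ s ∈ Finset.range n, D t s := Finset.sum_nonneg fun _ _ => hD0 _ _
        have ih := ih (by omega)
        rw [Finset.sum_range_succ _ t]
        by_cases hA : armAt (oneBitPolicy g tie) messagePolicy x (t + 1) = k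
        · have hs : N (t + 1) k = N t k + 1 := by simp [hN, pulls_succ, hA]
          rw [hs, Finset.sum_range_succ]
          push_cast
          suffices 1 ≤ ∑ s ∈ Finset.range n, D t s + ψ (N t k) by linarith
          rcases pulls_oneBit_succ_cases g tie hg₁ hg₂ hg₃ hx hK best k hv0 hvy hy1
            (show t < n by omega) htK hA with ⟨s, hs, h⟩ | h | h
          · have : D t s = 1 := if_pos h
            have := Finset.single_le_sum (f := fun s => D t s) (fun s _ => hD0 t s) hs
            linarith [hψ0 (N t k)]
          · have : 1 ≤ ψ (N t k) := by
              simp only [hψ, hN]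
              rw [if_pos h]
              split_ifs <;> norm_num
            linarith
          · have : 1 ≤ ψ (N t k) := by
              simp only [hψ, hN]
              rw [if_pos h]
              split_ifs <;> norm_num
            linarith
        · have hs : N (t + 1) k = N t k := by simp [hN, pulls_succ, hA]
          rw [hs]
          linarith
  refine (key n le_rfl).trans (add_le_add_right ?_ _)
  exact Finset.sum_le_sum_of_subset_of_nonneg
    (Finset.range_subset_range.2 (pulls_le _ _ _ n k)) fun _ _ _ => hψ0 _

end OneBitPulls

/-! ### One-bit policy: upper bound in expectation -/

section OneBitExpectation

variable {Ω : Type*} [MeasurableSpace Ω] {P : Measure Ω}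

theorem integrable_ite_one [IsFiniteMeasure P] {p : Ω → Prop} [DecidablePred p]
    (hp : MeasurableSet {ω | p ω}) :
    Integrable (fun ω => if p ω then (1 : ℝ) else 0) P :=
  .of_bound (Measurable.ite hp measurable_const measurable_const).aestronglyMeasurable 1 <|
    .of_forall fun ω => by split_ifs <;> simp

theorem integral_ite_one {p : Ω → Prop} [DecidablePred p] (hp : MeasurableSet {ω | p ω}) :
    ∫ ω, (if p ω then (1 : ℝ) else 0) ∂P = P.real {ω | p ω} := by
  rw [← integral_indicator_one hp]
  congr 1
  funext ω
  by_cases h : p ω <;> simp [h]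

theorem measurable_klBern (q : ℝ) : Measurable fun x => klBern x q := by
  unfold klBern
  fun_prop

theorem measurable_estimate {Y : ℕ → Ω → ℝ} (hY : ∀ j, Measurable (Y j)) (s : ℕ) :
    Measurable fun ω => estimate (fun j => Y j ω) s :=
  (measurable_quantize _).comp (measurable_avg hY _)

variable {K : ℕ} {g : ℕ → ℝ → ℕ → ℝ} {μ : Fin K → ℝ} {X : Fin K → ℕ → Ω → ℝ}

theorem measurable_oneBit_index (hg₁ : Monotonicity g) (hX : ∀ k, IndepUnitSeq P (μ k) (X k))
    (t : ℕ) (k : Fin K) (s : ℕ) :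
    Measurable fun ω => (fun (t : ℕ) (m : List Bool) => g t (decode m) (eta m.length)) (t + 1)
      (sent bit (fun j => X k j ω) s) := by
  rcases Nat.eq_zero_or_pos s with rfl | hs
  · simp only [sent, List.range_zero, List.map_nil]
    exact measurable_const
  · simp only [decode_sent (fun j => (hX k).mem j _) hs, length_sent]
    exact measurable_decision hg₁ (by omega) (one_le_eta s)
      (measurable_estimate (hX k).meas s) fun ω => estimate_mem_Icc (fun j => (hX k).mem j ω) s

/-- By `exists_le_eta`, the packet delay costs only a factor `1 + ε` and a constant. -/
theorem exists_sum_ite_eta_lt_le {ε : ℝ} (hε : 0 < ε) :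
    ∃ C : ℝ, ∀ n S : ℕ,
      ∑ s ∈ Finset.range n, (if 1 ≤ s ∧ eta s < S then (1 : ℝ) else 0) ≤ (1 + ε) * S + C := by
  obtain ⟨C, hC0, hC⟩ := exists_le_eta hε
  refine ⟨C + 1, fun n S => ?_⟩
  rw [Finset.sum_boole]
  have hsub : (Finset.range n).filter (fun s => 1 ≤ s ∧ eta s < S)
      ⊆ Finset.range (⌊(1 + ε) * S + C⌋₊ + 1) := by
    intro s hs
    obtain ⟨-, hs1, hs2⟩ := Finset.mem_filter.1 hs
    rw [Finset.mem_range, Nat.lt_succ_iff]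
    refine Nat.le_floor ((hC s hs1).trans ?_)
    have : (eta s : ℝ) ≤ S := by exact_mod_cast hs2.le
    gcongr
  have h1 := Finset.card_le_card hsub
  rw [Finset.card_range] at h1
  have h2 : (((Finset.range n).filter fun s => 1 ≤ s ∧ eta s < S).card : ℝ)
      ≤ ⌊(1 + ε) * S + C⌋₊ + 1 := by exact_mod_cast h1
  have h3 := Nat.floor_le (show 0 ≤ (1 + ε) * S + C by positivity)
  linarith

open Classical in
theorem exists_integral_pulls_oneBit_le [IsProbabilityMeasure P] (hg₁ : Monotonicity g)
    (hg₂ : ConvergesToAverage g)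
    (hg₃ : SufficientlyAbove g) (tie : TieBreak K) (hX : ∀ k, IndepUnitSeq P (μ k) (X k))
    (best k : Fin K) {δ ε : ℝ} (hε : 0 < ε) (hδ : 0 < δ) (hk0 : 0 < μ k)
    (hδk : μ k + δ < μ best - δ) (hb1 : μ best < 1) :
    ∃ C : ℝ, ∀ n : ℕ,
      ∫ ω, (pulls (oneBitPolicy g tie) messagePolicy (fun k j => X k j ω) n k : ℝ) ∂P
        ≤ (1 + ε) * pullsBelow g n (μ k + δ) (μ best - δ) + C := by
  have hK : 1 ≤ K := (Nat.zero_le _).trans_lt k.2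
  set v := μ k + δ with hv
  set y := μ best - δ with hy
  obtain ⟨C₁, hC₁⟩ := exists_sum_ite_eta_lt_le hε
  obtain ⟨s₀, hs₀⟩ := exists_estimate_le (half_pos hδ)
  -- Of the margin `δ`, one half pays for rounding once `s ≥ s₀`, the other for the deviation of the
  -- average.
  obtain ⟨c, hc, htail⟩ := (hX k).exists_measureReal_le_avg hk0 (y := v - δ / 2)
    (by linarith) (by linarith)
  have hy0 : 0 < y := by linarith
  have hyb : y < μ best := by linarith
  have hd : 0 < klBern y (μ best) :=
    klBern_pos hy0.le (hyb.trans hb1) ⟨hy0.trans hyb, hb1⟩ hyb.ne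
  have hsc := summable_exp_eta hc
  have hsd := summable_exp_eta hd
  have hse : Summable fun t => (explore (t + 1))⁻¹ :=
    (summable_nat_add_iff 1).2 summable_inv_explore
  let A : ℕ → Ω → ℝ := fun s ω => avg (fun j => X k j ω) (eta s)
  let B : ℕ → Ω → ℝ := fun s ω => avg (fun j => X best j ω) (eta s)
  let D : ℕ → ℕ → Ω → Prop := fun t s ω =>
    B s ω ≤ y ∧ Real.log (explore (t + 1)) / eta s ≤ klBern (B s ω) y
  have hBm : ∀ s, Measurable (B s) := fun s => measurable_avg (hX best).meas _
  have hDm : ∀ t s, MeasurableSet {ω | D t s ω} := fun t s =>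
    (measurableSet_le (hBm s) measurable_const).inter
      (measurableSet_le measurable_const ((measurable_klBern y).comp (hBm s)))
  have hAm : ∀ s, MeasurableSet {ω | v - δ / 2 ≤ A s ω} := fun s =>
    measurableSet_le measurable_const (measurable_avg (hX k).meas _)
  have hDP : ∀ t s, P.real {ω | D t s ω}
      ≤ (explore (t + 1))⁻¹ * Real.exp (-(eta s * klBern y (μ best))) := by
    intro t s
    refine ((hX best).measureReal_klBern_le hb1 hy0 hyb _ _).trans_eq ?_
    have : (eta s : ℝ) ≠ 0 := by have := one_le_eta s; positivity
    -- The bound factors into a function of `t` and one of `s`, both summable, so the double sum is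
    -- bounded independently of `n`.
    rw [mul_add, mul_div_cancel₀ _ this, neg_add, Real.exp_add, Real.exp_neg,
      Real.exp_log (one_pos.trans_le (one_le_explore _))]
  refine ⟨K + (∑' t, (explore (t + 1))⁻¹) * (∑' s, Real.exp (-(eta s * klBern y (μ best))))
    + C₁ + s₀ + ∑' s, Real.exp (-(eta s * c)), fun n => ?_⟩
  set S := pullsBelow g n v y with hS
  have hpath : ∀ ω, (pulls (oneBitPolicy g tie) messagePolicy (fun k j => X k j ω) n k : ℝ)
      ≤ (K + ((1 + ε) * S + C₁) + s₀)
        + (∑ t ∈ Finset.range n, ∑ s ∈ Finset.range n, (if D t s ω then 1 else 0)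
          + ∑ s ∈ Finset.range n, if v - δ / 2 ≤ A s ω then 1 else 0) := by
    intro ω
    have h1 := pulls_oneBit_le g tie hg₁ hg₂ hg₃ (x := fun k j => X k j ω)
      (fun k j => (hX k).mem j ω) hK best k (by linarith) hδk (by linarith) n
    have h2 : ∑ s ∈ Finset.range n, (if v < estimate (fun j => X k j ω) s then (1 : ℝ) else 0)
        ≤ s₀ + ∑ s ∈ Finset.range n, if v - δ / 2 ≤ A s ω then 1 else 0 := by
      have h3 : ∑ s ∈ Finset.range n, (if s < s₀ then (1 : ℝ) else 0) ≤ s₀ := by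
        rw [Finset.sum_boole]
        have : ((Finset.range n).filter fun s => s < s₀) ⊆ Finset.range s₀ := fun s hs =>
          Finset.mem_range.2 (Finset.mem_filter.1 hs).2
        simpa using Finset.card_le_card this
      refine le_trans ?_ (add_le_add_left h3 _)
      rw [← Finset.sum_add_distrib]
      refine Finset.sum_le_sum fun s _ => ?_
      rcases lt_or_ge s s₀ with h | h
      · rw [if_pos h]
        split_ifs <;> norm_num
      · have h4 := hs₀ s h fun j => X k j ω
        rw [if_neg h.not_gt, zero_add]
        by_cases h5 : v < estimate (fun j => X k j ω) s
        · rw [if_pos h5, if_pos (by simp only [A]; linarith)]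
        · rw [if_neg h5]
          split_ifs <;> norm_num
    have h6 := hC₁ n S
    rw [Finset.sum_add_distrib] at h1
    simp only [D, B]
    linarith
  have hint : Integrable (fun ω =>
      ∑ t ∈ Finset.range n, ∑ s ∈ Finset.range n, (if D t s ω then (1 : ℝ) else 0)) P :=
    integrable_finsetSum _ fun t _ => integrable_finsetSum _ fun s _ => integrable_ite_one (hDm t s)
  have hint' : Integrable (fun ω =>
      ∑ s ∈ Finset.range n, if v - δ / 2 ≤ A s ω then (1 : ℝ) else 0) P :=
    integrable_finsetSum _ fun s _ => integrable_ite_one (hAm s)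
  have hint2 : Integrable (fun ω =>
      ∑ t ∈ Finset.range n, ∑ s ∈ Finset.range n, (if D t s ω then (1 : ℝ) else 0)
        + ∑ s ∈ Finset.range n, if v - δ / 2 ≤ A s ω then (1 : ℝ) else 0) P := hint.add hint'
  calc _ ≤ ∫ ω, ((K + ((1 + ε) * S + C₁) + s₀)
        + (∑ t ∈ Finset.range n, ∑ s ∈ Finset.range n, (if D t s ω then 1 else 0)
          + ∑ s ∈ Finset.range n, if v - δ / 2 ≤ A s ω then 1 else 0)) ∂P :=
        integral_mono (integrable_pulls tie _ bit X P (measurable_oneBit_index hg₁ hX) n k)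
          ((integrable_const _).add hint2) hpath
    _ = (K + ((1 + ε) * S + C₁) + s₀)
        + (∑ t ∈ Finset.range n, ∑ s ∈ Finset.range n, P.real {ω | D t s ω}
          + ∑ s ∈ Finset.range n, P.real {ω | v - δ / 2 ≤ A s ω}) := by
        rw [integral_add (integrable_const _) hint2, integral_add hint hint',
          integral_finsetSum _ fun t _ => integrable_finsetSum _ fun s _ =>
            integrable_ite_one (hDm t s),
          integral_finsetSum _ fun s _ => integrable_ite_one (hAm s)]
        simp only [integral_ite_one (hAm _)]
        simp only [integral_finsetSum _ fun s _ => integrable_ite_one (hDm _ s),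
          integral_ite_one (hDm _ _)]
        simp
    _ ≤ (K + ((1 + ε) * S + C₁) + s₀)
        + ((∑' t, (explore (t + 1))⁻¹) * (∑' s, Real.exp (-(eta s * klBern y (μ best))))
          + ∑' s, Real.exp (-(eta s * c))) := by
        gcongr
        · calc _ ≤ ∑ t ∈ Finset.range n, ∑ s ∈ Finset.range n,
                (explore (t + 1))⁻¹ * Real.exp (-(eta s * klBern y (μ best))) :=
              Finset.sum_le_sum fun t _ => Finset.sum_le_sum fun s _ => hDP t s
            _ = (∑ t ∈ Finset.range n, (explore (t + 1))⁻¹)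
                * ∑ s ∈ Finset.range n, Real.exp (-(eta s * klBern y (μ best))) := by
              rw [Finset.sum_mul_sum]
            _ ≤ _ := by
              have hpos : ∀ t, 0 ≤ (explore (t + 1))⁻¹ := fun t =>
                inv_nonneg.2 (zero_le_one.trans (one_le_explore _))
              gcongr
              · exact tsum_nonneg hpos
              · exact hse.sum_le_tsum _ fun t _ => hpos t
              · exact hsd.sum_le_tsum _ fun s _ => (Real.exp_pos _).le
        · exact (Finset.sum_le_sum fun s _ => htail _ (one_le_eta s)).trans
            (hsc.sum_le_tsum _ fun s _ => (Real.exp_pos _).le)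
    _ = _ := by ring

end OneBitExpectation

/-! ### Full-reward policy: lower bound -/

section FullReward

/-- The last of the rewards so far. -/
def lastReward (r : List ℝ) : ℝ := r.getLastD 0

theorem fullReward_eq : fullReward = fun _ => lastReward := rfl

theorem sent_lastReward (y : ℕ → ℝ) (s : ℕ) : sent lastReward y s = (List.range s).map y := by
  simp [sent, lastReward, List.range_succ]

theorem sum_sent_div (y : ℕ → ℝ) (s : ℕ) : (sent lastReward y s).sum / s = avg y s := by
  rw [sent_lastReward, avg, ← List.sum_toFinset _ List.nodup_range,
    List.toFinset_range]

variable {K : ℕ} {g : ℕ → ℝ → ℕ → ℝ} {μ : Fin K → ℝ}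

/-- If all averages over at least `s₀` pulls are accurate, then an arm that is pulled too rarely has
the largest index during a whole stretch of rounds, and the other arms are pulled rarely in it. -/
theorem pullsBelow_le_pulls_ucb (hg₁ : Monotonicity g) (hg₂ : ConvergesToAverage g)
    (tie : TieBreak K) {x : Fin K → ℕ → ℝ} (hx : ∀ k j, x k j ∈ Set.Icc (0 : ℝ) 1) (k : Fin K)
    {b δ : ℝ} (hδ : 0 < δ) (hk0 : 0 < μ k - δ) (hb : ∀ j, μ j ≤ b) (hb1 : b + δ < 1)
    {s₀ m n : ℕ} (hs₀ : 1 ≤ s₀)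
    (hgood : ∀ s, s₀ ≤ s → ∀ j, |avg (x j) s - μ j| ≤ δ / 2) (hm1 : 1 ≤ m) (hKm : K ≤ m)
    (hz : b + δ < g m 0 s₀)
    (hn : m + K * (s₀ + pullsBelow g n (b + δ / 2) (b + δ) + pullsBelow g m (μ k - δ) (b + δ)) ≤ n) :
    pullsBelow g m (μ k - δ) (b + δ) ≤ pulls (ucbPolicy g tie) fullReward x n k := by
  have hb0 : 0 < b := by linarith [hb k]
  have hz01 : (0 : ℝ) ∈ Set.Icc (0 : ℝ) 1 := ⟨le_rfl, zero_le_one⟩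
  have hmn : m ≤ n := by omega
  rw [fullReward_eq]
  set Q := pullsBelow g n (b + δ / 2) (b + δ) with hQ
  set S := pullsBelow g m (μ k - δ) (b + δ) with hS
  have hmono := fun j => pulls_mono (ucbPolicy g tie) (fun _ => lastReward) x j
  have hpos : ∀ t, K ≤ t → ∀ j, 1 ≤ pulls (ucbPolicy g tie) (fun _ => lastReward) x t j :=
    fun t ht j => one_le_pulls (fun _ => lastReward) x tie _ ht j
  set N := pulls (ucbPolicy g tie) (fun _ => lastReward) x with hN
  by_contra! hlt
  have hindex : ∀ t, m ≤ t → t < n → b + δ < g (t + 1) (avg (x k) (N t k)) (N t k) := by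
    intro t hmt htn
    have hs1 := hpos t (hKm.trans hmt) k
    have hsS : N t k < S := (hmono k htn.le).trans_lt hlt
    have ha := avg_mem_Icc (hx k) (N t k)
    rcases lt_or_ge (N t k) s₀ with h | h
    -- With fewer than `s₀` pulls the average is uncontrolled, but even average zero has a large
    -- index at time `m`.
    · calc b + δ < g m 0 s₀ := hz
        _ ≤ g m 0 (N t k) := hg₁.pulls 0 hz01 _ _ m hs1 h.le hm1
        _ ≤ g (t + 1) 0 (N t k) := hg₁.time 0 hz01 _ _ _ hs1 hm1 (by omega)
        _ ≤ _ := hg₁.average 0 hz01 _ ha _ _ hs1 (by omega) ha.1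
    · have hk := (abs_le.1 (hgood _ h k)).1
      have hk01 : μ k - δ ∈ Set.Icc (0 : ℝ) 1 := ⟨hk0.le, by linarith [hb k]⟩
      calc b + δ < g m (μ k - δ) (N t k) := lt_of_lt_pullsBelow hs1 hsS
        _ ≤ g (t + 1) (μ k - δ) (N t k) := hg₁.time _ hk01 _ _ _ hs1 hm1 (by omega)
        _ ≤ _ := hg₁.average _ hk01 _ ha _ _ hs1 (by omega) (by linarith)
  have hother : ∀ t, m ≤ t → t ≤ n → ∀ j, j ≠ k → N t j ≤ max (N m j) (s₀ + Q) := by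
    intro t hmt
    induction t, hmt using Nat.le_induction with
    | base => exact fun _ j _ => le_max_left _ _
    | succ t hmt ih =>
      intro htn j hj
      have ih := ih (by omega) j hj
      by_cases hA : armAt (ucbPolicy g tie) (fun _ => lastReward) x (t + 1) = j
      · have hidx := index_le_index_armAt lastReward x tie
          (fun t r => g t (r.sum / r.length) r.length) (hKm.trans hmt) hA k
        simp only [length_sent, sum_sent_div] at hidx
        change g (t + 1) (avg (x k) (N t k)) (N t k) ≤ g (t + 1) (avg (x j) (N t j)) (N t j) at hidx
        have hz' := (hindex t hmt (by omega)).trans_le hidx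
        -- With at least `s₀ + Q` pulls, the accurate average is at most `b + δ / 2` and the index
        -- at most `b + δ`, so `j` could not beat `k`.
        have hlt : N t j < s₀ + Q := by
          by_contra! h
          have hs1 := hpos t (hKm.trans hmt) j
          have ha := avg_mem_Icc (hx j) (N t j)
          have hj1 := (abs_le.1 (hgood _ ((Nat.le_add_right _ _).trans h) j)).2
          have hb01 : b + δ / 2 ∈ Set.Icc (0 : ℝ) 1 := ⟨by linarith, by linarith⟩
          have h1 := hg₁.average _ ha _ hb01 (N t j) (t + 1) hs1 (by omega) (by linarith [hb j])
          have h2 := hg₁.time _ hb01 (N t j) (t + 1) n hs1 (by omega) htn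
          have h3 := le_of_pullsBelow_le hg₁ hg₂ (by omega : 1 ≤ n) (by linarith : 0 < b + δ / 2)
            (by linarith : b + δ / 2 < b + δ) hb1 ((Nat.le_add_left Q s₀).trans h)
          linarith
        have hs : N (t + 1) j = N t j + 1 := by simp [hN, pulls_succ, hA]
        rw [hs]
        exact le_max_of_le_right hlt
      · have hs : N (t + 1) j = N t j := by simp [hN, pulls_succ, hA]
        rw [hs]
        exact ih
  -- The gain of one per arm makes the final count strict: summed over the arms it contradicts the
  -- length of the stretch.
  have hstep : ∀ j, N n j ≤ N m j + (s₀ + Q + S) - 1 := by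
    intro j
    rcases eq_or_ne j k with rfl | hj
    · omega
    · have := hother n hmn le_rfl j hj
      omega
  have hstep' : ∀ j, N n j + 1 ≤ N m j + (s₀ + Q + S) := fun j => by
    have := hstep j
    omega
  have hsum := Finset.sum_le_sum fun j (_ : j ∈ Finset.univ) => hstep' j
  rw [Finset.sum_add_distrib, Finset.sum_add_distrib, sum_pulls, sum_pulls] at hsum
  simp only [Finset.sum_const, Finset.card_univ, Fintype.card_fin, smul_eq_mul, mul_one] at hsum
  have := k.2
  omega

theorem eventually_lt_index_zero (hg₃ : SufficientlyAbove g) {z : ℝ} (hz1 : z < 1)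
    {s : ℕ} (hs : 1 ≤ s) : ∀ᶠ t in atTop, z < g t 0 s := by
  have h := tendsto_log_explore.atTop_div_const (show (0 : ℝ) < s by exact_mod_cast hs)
  filter_upwards [h.eventually_gt_atTop (klBern 0 z), eventually_ge_atTop 2] with t ht ht2
  by_contra! hle
  linarith [(log_explore_div_le_klBern hg₃ ht2 hs le_rfl one_pos hz1 hle).2]

theorem tendsto_ceil_mul {c : ℝ} (hc : 0 < c) :
    Tendsto (fun n : ℕ => ⌈c * (n : ℝ)⌉₊) atTop atTop :=
  tendsto_nat_ceil_atTop.comp (tendsto_natCast_atTop_atTop.const_mul_atTop hc)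

theorem eventually_le_mul_of_sublinear (hg₄ : Sublinear g) {x₁ x₂ c : ℝ} (h0 : 0 < x₁)
    (h12 : x₁ < x₂) (h1 : x₂ < 1) (hc : 0 < c) :
    ∀ᶠ t : ℕ in atTop, (pullsBelow g t x₁ x₂ : ℝ) ≤ c * t := by
  filter_upwards [(hg₄ x₁ x₂ h0 h12 h1).eventually (ge_mem_nhds hc), eventually_gt_atTop 0]
    with t ht ht0
  rwa [div_le_iff₀ (by exact_mod_cast ht0)] at ht

/-- The last stretch of rounds is long compared to the numbers of pulls that an index above
`b + δ` allows. -/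
theorem eventually_stretch (hg₄ : Sublinear g) {b δ a : ℝ} (hδ : 0 < δ)
    (ha0 : 0 < a) (hab : a < b + δ) (hb0 : 0 < b) (hb1 : b + δ < 1) (K s₀ : ℕ) :
    ∀ᶠ n : ℕ in atTop, ⌈(1 - δ) * (n : ℝ)⌉₊ + K * (s₀ + pullsBelow g n (b + δ / 2) (b + δ)
      + pullsBelow g ⌈(1 - δ) * (n : ℝ)⌉₊ a (b + δ)) ≤ n := by
  -- The stretch has length about `δ * n`: a quarter of it suffices for each of the two thresholds
  -- times `K`, and another for `K * s₀` and the ceiling.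
  have hc : 0 < δ / (4 * (K + 1)) := by positivity
  have hδ1 : 0 < 1 - δ := by linarith
  have h1 := eventually_le_mul_of_sublinear hg₄ (by linarith : 0 < b + δ / 2)
    (by linarith : b + δ / 2 < b + δ) hb1 hc
  have h2 := (tendsto_ceil_mul hδ1).eventually
    (eventually_le_mul_of_sublinear hg₄ ha0 hab hb1 hc)
  have h3 := (tendsto_natCast_atTop_atTop.const_mul_atTop
    (show 0 < δ / 4 by positivity)).eventually_ge_atTop (1 + (K * s₀ : ℝ))
  filter_upwards [h1, h2, h3] with n h1 h2 h3
  have hmn : ⌈(1 - δ) * (n : ℝ)⌉₊ ≤ n := Nat.ceil_le.2 (by nlinarith [n.cast_nonneg (α := ℝ)])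
  have hmn' : (⌈(1 - δ) * (n : ℝ)⌉₊ : ℝ) ≤ n := by exact_mod_cast hmn
  have hm := (Nat.ceil_lt_add_one (show 0 ≤ (1 - δ) * (n : ℝ) by positivity)).le
  have h2' := h2.trans (mul_le_mul_of_nonneg_left hmn' hc.le)
  have hK : (K : ℝ) * (δ / (4 * (K + 1)) * n) ≤ δ / 4 * n := by
    have : (K : ℝ) * (δ / (4 * (K + 1)) * n) = (K / (K + 1)) * (δ / 4 * n) := by
      field_simp
    rw [this]
    exact mul_le_of_le_one_left (by positivity) (div_le_one_of_le₀ (by linarith) (by positivity))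
  have h4 := mul_le_mul_of_nonneg_left h1 (K.cast_nonneg (α := ℝ))
  have h5 := mul_le_mul_of_nonneg_left h2' (K.cast_nonneg (α := ℝ))
  rw [← Nat.cast_le (α := ℝ)]
  push_cast
  nlinarith [n.cast_nonneg (α := ℝ)]

variable {Ω : Type*} [MeasurableSpace Ω] {P : Measure Ω}
  {X : Fin K → ℕ → Ω → ℝ}

theorem measurable_ucb_index (hg₁ : Monotonicity g) (hX : ∀ k, IndepUnitSeq P (μ k) (X k))
    (t : ℕ) (k : Fin K) (s : ℕ) :
    Measurable fun ω => (fun (t : ℕ) (r : List ℝ) => g t (r.sum / r.length) r.length) (t + 1)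
      (sent lastReward (fun j => X k j ω) s) := by
  simp only [length_sent, sum_sent_div]
  rcases Nat.eq_zero_or_pos s with rfl | hs
  · simp only [avg, Finset.range_zero, Finset.sum_empty]
    exact measurable_const
  · exact measurable_decision hg₁ (by omega) hs (measurable_avg (hX k).meas s)
      fun ω => avg_mem_Icc (fun j => (hX k).mem j ω) s

/-- All averages over at least `s₀` pulls are accurate up to `ε`. -/
def accurate (X : Fin K → ℕ → Ω → ℝ) (μ : Fin K → ℝ) (ε : ℝ) (s₀ : ℕ) : Set Ω :=
  {ω | ∀ s, s₀ ≤ s → ∀ k, |avg (fun j => X k j ω) s - μ k| ≤ ε}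

theorem measurableSet_accurate (hX : ∀ k, IndepUnitSeq P (μ k) (X k)) (ε : ℝ) (s₀ : ℕ) :
    MeasurableSet (accurate X μ ε s₀) := by
  simp only [accurate, Set.ofPred_forall]
  exact .iInter fun s => .iInter fun _ => .iInter fun k => measurableSet_le
    (continuous_abs.measurable.comp ((measurable_avg (hX k).meas s).sub_const _)) measurable_const

/-- By the strong law for each of the finitely many arms, the increasing events exhaust the space
almost surely. No joint law across arms enters. -/
theorem tendsto_measureReal_accurate [IsProbabilityMeasure P]
    (hX : ∀ k, IndepUnitSeq P (μ k) (X k))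
    (hident : ∀ k j, IdentDistrib (X k j) (X k 0) P P) {ε : ℝ} (hε : 0 < ε) :
    Tendsto (fun s₀ => P.real (accurate X μ ε s₀)) atTop (𝓝 1) := by
  have hmono : Monotone (accurate X μ ε) := fun a b hab ω hω s hs => hω s (hab.trans hs)
  have hae : ∀ᵐ ω ∂P, ω ∈ ⋃ s₀, accurate X μ ε s₀ := by
    have hlaw : ∀ᵐ ω ∂P, ∀ k, Tendsto (fun s => avg (fun j => X k j ω) s) atTop (𝓝 (μ k)) := by
      refine ae_all_iff.2 fun k => ?_
      have := strong_law_ae_real (X k) ((hX k).integrable 0)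
        (fun i j hij => (hX k).indep.indepFun hij) (hident k)
      simpa only [(hX k).mean, avg] using this
    filter_upwards [hlaw] with ω hω
    have h : ∀ᶠ s in atTop, ∀ k, |avg (fun j => X k j ω) s - μ k| ≤ ε :=
      eventually_all.2 fun k => by
        filter_upwards [Metric.tendsto_nhds.1 (hω k) ε hε] with s hs
        exact (Real.dist_eq _ _ ▸ hs).le
    obtain ⟨s₀, hs₀⟩ := eventually_atTop.1 h
    exact Set.mem_iUnion.2 ⟨s₀, hs₀⟩
  have h := tendsto_measure_iUnion_atTop (μ := P) hmono
  rw [show P (⋃ s₀, accurate X μ ε s₀) = 1 by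
    exact (measure_congr (eventuallyEq_univ.2 hae)).trans measure_univ] at h
  exact (ENNReal.tendsto_toReal ENNReal.one_ne_top).comp h

/-- Choose `s₀` once so that accuracy has probability at least `1 - ε`; on that event the pathwise
bound holds for all large `n`. -/
theorem eventually_le_integral_pulls_ucb [IsProbabilityMeasure P] (hg₁ : Monotonicity g)
    (hg₂ : ConvergesToAverage g)
    (hg₃ : SufficientlyAbove g) (hg₄ : Sublinear g) (tie : TieBreak K)
    (hX : ∀ k, IndepUnitSeq P (μ k) (X k)) (hident : ∀ k j, IdentDistrib (X k j) (X k 0) P P)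
    (k : Fin K) {b δ ε : ℝ} (hδ : 0 < δ) (hk0 : 0 < μ k - δ) (hb : ∀ j, μ j ≤ b)
    (hb1 : b + δ < 1) (hε : 0 < ε) :
    ∀ᶠ n : ℕ in atTop, (1 - ε) * pullsBelow g ⌈(1 - δ) * (n : ℝ)⌉₊ (μ k - δ) (b + δ)
      ≤ ∫ ω, (pulls (ucbPolicy g tie) fullReward (fun k j => X k j ω) n k : ℝ) ∂P := by
  have hb0 : 0 < b := by linarith [hb k]
  obtain ⟨s₀, hs₀, hprob⟩ := ((eventually_ge_atTop 1).and
    ((tendsto_measureReal_accurate hX hident (half_pos hδ)).eventually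
      (le_mem_nhds (show 1 - ε < 1 by linarith)))).exists
  have hceil := tendsto_ceil_mul (show 0 < 1 - δ by linarith)
  filter_upwards [hceil.eventually (eventually_ge_atTop (max 1 K)),
    hceil.eventually (eventually_lt_index_zero hg₃ hb1 hs₀),
    eventually_stretch hg₄ hδ hk0 (by linarith [hb k]) hb0 hb1 K s₀] with n h1 h2 h3
  set S := pullsBelow g ⌈(1 - δ) * (n : ℝ)⌉₊ (μ k - δ) (b + δ)
  have hE := measurableSet_accurate hX (δ / 2) s₀
  calc (1 - ε) * S ≤ P.real (accurate X μ (δ / 2) s₀) * S := by gcongr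
    _ = ∫ ω, (accurate X μ (δ / 2) s₀).indicator (fun _ => (S : ℝ)) ω ∂P := by
        rw [integral_indicator_const _ hE, smul_eq_mul]
    _ ≤ _ := by
        refine integral_mono ((integrable_const _).indicator hE)
          (integrable_pulls tie _ lastReward X P (measurable_ucb_index hg₁ hX) n k)
          (Set.indicator_le' (fun ω hω => ?_) fun ω _ => Nat.cast_nonneg _)
        exact Nat.cast_le.2 (pullsBelow_le_pulls_ucb hg₁ hg₂ tie (fun k j => (hX k).mem j ω) k hδ
          hk0 hb hb1 hs₀ hω ((le_max_left _ _).trans h1) ((le_max_right _ _).trans h1) h2 h3)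

end FullReward

/-! ### Comparison of the two policies -/

section Comparison

variable {K : ℕ} {g : ℕ → ℝ → ℕ → ℝ} {μ : Fin K → ℝ} {Ω : Type*} [MeasurableSpace Ω]
  {P : Measure Ω} [IsProbabilityMeasure P] {X : Fin K → ℕ → Ω → ℝ}

/-- For small `δ`, the numbers of pulls at the two perturbed levels are comparable. -/
theorem exists_eventually_pullsBelow_le (hg₂ : ConvergesToAverage g) (hg₅ : AsymptoticContinuity g)
    {x₁ x₂ r : ℝ} (h0 : 0 < x₁) (h12 : x₁ < x₂) (h1 : x₂ < 1) (hr : 1 < r) :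
    ∃ δ, 0 < δ ∧ δ < x₁ ∧ δ < 1 - x₂ ∧ δ < (x₂ - x₁) / 2 ∧
      ∀ᶠ n : ℕ in atTop, (pullsBelow g n (x₁ + δ) (x₂ - δ) : ℝ)
        ≤ r * pullsBelow g ⌈(1 - δ) * (n : ℝ)⌉₊ (x₁ - δ) (x₂ + δ) := by
  set M := min x₁ (min (1 - x₂) ((x₂ - x₁) / 2)) with hM
  have hM0 : 0 < M := lt_min h0 (lt_min (by linarith) (by linarith))
  have hδ : ∀ i : ℕ, 0 < M / ((i : ℝ) + 2) ∧ M / ((i : ℝ) + 2) < M := fun i =>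
    ⟨by positivity, div_lt_self hM0 (by have := i.cast_nonneg (α := ℝ); linarith)⟩
  have hlim : Tendsto (fun i : ℕ => M / ((i : ℝ) + 2)) atTop (𝓝 0) :=
    tendsto_const_nhds.div_atTop
      (tendsto_atTop_add_const_right _ _ tendsto_natCast_atTop_atTop)
  obtain ⟨L, hL, hL1⟩ := hg₅ x₁ x₂ h0 h12 h1 _ hδ hlim
  -- A single perturbation is enough: any `i` with `L i < r`.
  obtain ⟨i, hi⟩ := (hL1.eventually (gt_mem_nhds hr)).exists
  obtain ⟨hd0, hdM⟩ := hδ i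
  have hLi := hL i
  set δ := M / ((i : ℝ) + 2)
  obtain ⟨hd1, hd2, hd3⟩ : δ < x₁ ∧ δ < 1 - x₂ ∧ δ < (x₂ - x₁) / 2 :=
    ⟨hdM.trans_le (min_le_left _ _),
      hdM.trans_le ((min_le_right _ _).trans (min_le_left _ _)),
      hdM.trans_le ((min_le_right _ _).trans (min_le_right _ _))⟩
  refine ⟨δ, hd0, hd1, hd2, hd3, ?_⟩
  filter_upwards [hLi.eventually (gt_mem_nhds hi),
    (tendsto_ceil_mul (show 0 < 1 - δ by linarith)).eventually_ge_atTop 1] with n hn hn1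
  have hS := one_le_pullsBelow hg₂ hn1 (by linarith : 0 < x₁ - δ)
    (by linarith : x₁ - δ < x₂ + δ) (by linarith)
  rw [div_lt_iff₀ (by exact_mod_cast hS)] at hn
  exact hn.le

theorem eventually_integral_pulls_oneBit_le (hg₁ : Monotonicity g) (hg₂ : ConvergesToAverage g)
    (hg₃ : SufficientlyAbove g) (hg₄ : Sublinear g) (hg₅ : AsymptoticContinuity g)
    (tie tie' : TieBreak K) (hX : ∀ k, IndepUnitSeq P (μ k) (X k))
    (hident : ∀ k j, IdentDistrib (X k j) (X k 0) P P) {best k : Fin K}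
    (hbest : ∀ j, μ j ≤ μ best) (hk : μ k < μ best) (hk0 : 0 < μ k) (hb1 : μ best < 1) {c : ℝ}
    (hc : 1 < c) :
    ∀ᶠ n : ℕ in atTop,
      ∫ ω, (pulls (oneBitPolicy g tie) messagePolicy (fun k j => X k j ω) n k : ℝ) ∂P
        ≤ c * ∫ ω, (pulls (ucbPolicy g tie') fullReward (fun k j => X k j ω) n k : ℝ) ∂P := by
  -- One factor `1 + ε` is for packet delay, one for the ratio of thresholds, the summand `ε` for
  -- the constant `C`, and `1 - ε` for the accuracy event.
  obtain ⟨ε, hε, hεc⟩ : ∃ ε > 0, (1 + ε) * (1 + ε) + ε < c * (1 - ε) := by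
    have hcont : ContinuousAt (fun ε : ℝ => c * (1 - ε) - ((1 + ε) * (1 + ε) + ε)) 0 := by fun_prop
    have h := hcont.eventually (lt_mem_nhds (a := 0) (by norm_num; exact hc))
    obtain ⟨ε, h1, h2⟩ := ((h.filter_mono nhdsWithin_le_nhds).and
      (self_mem_nhdsWithin (a := (0 : ℝ)) (s := Set.Ioi 0))).exists
    exact ⟨ε, h2, by linarith⟩
  obtain ⟨δ, hδ, hδ1, hδ2, hδ3, hcomp⟩ :=
    exists_eventually_pullsBelow_le hg₂ hg₅ hk0 hk hb1 (show 1 < 1 + ε by linarith)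
  obtain ⟨C, hC⟩ := exists_integral_pulls_oneBit_le hg₁ hg₂ hg₃ tie hX best k hε hδ hk0
    (by linarith) hb1
  have hlow := eventually_le_integral_pulls_ucb hg₁ hg₂ hg₃ hg₄ tie' hX hident k hδ (by linarith)
    hbest (by linarith) hε
  have hlarge := ((tendsto_pullsBelow hg₂ hg₃ (by linarith : 0 < μ k - δ)
    (by linarith : μ k - δ < μ best + δ) (by linarith)).comp
    (tendsto_ceil_mul (show 0 < 1 - δ by linarith))).eventually_ge_atTop (C / ε)
  filter_upwards [hcomp, hlow, hlarge] with n h1 h2 h3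
  simp only [Function.comp_apply] at h3
  rw [div_le_iff₀ hε] at h3
  have h4 := hC n
  set S' : ℝ := (pullsBelow g ⌈(1 - δ) * (n : ℝ)⌉₊ (μ k - δ) (μ best + δ) : ℝ)
  have hS' : 0 ≤ S' := Nat.cast_nonneg _
  calc _ ≤ (1 + ε) * pullsBelow g n (μ k + δ) (μ best - δ) + C := h4
    _ ≤ (1 + ε) * ((1 + ε) * S') + S' * ε := by gcongr
    _ = ((1 + ε) * (1 + ε) + ε) * S' := by ring
    _ ≤ c * (1 - ε) * S' := by gcongr
    _ = c * ((1 - ε) * S') := by ring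
    _ ≤ _ := by gcongr

theorem iSup_mean_eq {best : Fin K} (hbest : ∀ j, μ j ≤ μ best) : ⨆ j, μ j = μ best :=
  have : Nonempty (Fin K) := ⟨best⟩
  le_antisymm (ciSup_le hbest) (le_ciSup (Set.finite_range μ).bddAbove best)

/-- The first two rounds play two different arms, and one of them is suboptimal. -/
theorem regret_ucb_pos (hK : 2 ≤ K) (hg₁ : Monotonicity g) (tie : TieBreak K)
    (hX : ∀ k, IndepUnitSeq P (μ k) (X k)) {best : Fin K} (hbest : ∀ k, k ≠ best → μ k < μ best)
    {n : ℕ} (hn : 2 ≤ n) : 0 < regret P μ X (ucbPolicy g tie) fullReward n := by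
  have hle : ∀ j, μ j ≤ μ best := fun j => by
    rcases eq_or_ne j best with rfl | h
    · exact le_rfl
    · exact (hbest j h).le
  rw [fullReward_eq]
  refine lt_of_lt_of_eq ?_
    (regret_eq_sum tie _ lastReward X P (measurable_ucb_index hg₁ hX) μ n).symm
  rw [iSup_mean_eq hle]
  obtain ⟨k, hk, hk2⟩ : ∃ k : Fin K, k ≠ best ∧ (k : ℕ) < 2 := by
    by_cases h : best = ⟨0, by omega⟩
    · exact ⟨⟨1, by omega⟩, by simp [h], by simp⟩
    · exact ⟨⟨0, by omega⟩, fun e => h e.symm, by simp⟩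
  refine Finset.sum_pos' (fun j _ => mul_nonneg (sub_nonneg.2 (hle j))
    (integral_nonneg fun ω => Nat.cast_nonneg _)) ⟨k, Finset.mem_univ k, ?_⟩
  refine mul_pos (sub_pos.2 (hbest k hk)) (one_pos.trans_le ?_)
  have h1 : ∀ ω, (1 : ℝ) ≤ pulls (indexPolicy tie fun t r => g t (r.sum / r.length) r.length)
      (fun _ => lastReward) (fun k j => X k j ω) n k := by
    intro ω
    have : 1 ≤ pulls (indexPolicy tie fun t r => g t (r.sum / r.length) r.length)
        (fun _ => lastReward) (fun k j => X k j ω) (k + 1) k := by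
      rw [pulls_succ, armAt_initial _ _ tie _ k.2]
      simp
    exact_mod_cast this.trans (pulls_mono _ _ _ k (by omega))
  calc (1 : ℝ) = ∫ _, (1 : ℝ) ∂P := by simp
    _ ≤ _ := integral_mono (integrable_const _)
      (integrable_pulls tie _ lastReward X P (measurable_ucb_index hg₁ hX) n k) h1

theorem eventually_regret_oneBit_le (hg₁ : Monotonicity g) (hg₂ : ConvergesToAverage g)
    (hg₃ : SufficientlyAbove g) (hg₄ : Sublinear g) (hg₅ : AsymptoticContinuity g)
    (tie tie' : TieBreak K) (hX : ∀ k, IndepUnitSeq P (μ k) (X k))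
    (hident : ∀ k j, IdentDistrib (X k j) (X k 0) P P) {best : Fin K}
    (hbest : ∀ k, k ≠ best → μ k < μ best) (hpos : ∀ k, 0 < μ k) (hb1 : μ best < 1) {c : ℝ}
    (hc : 1 < c) :
    ∀ᶠ n : ℕ in atTop, regret P μ X (oneBitPolicy g tie) messagePolicy n
      ≤ c * regret P μ X (ucbPolicy g tie') fullReward n := by
  have hle : ∀ j, μ j ≤ μ best := fun j => by
    rcases eq_or_ne j best with rfl | h
    · exact le_rfl
    · exact (hbest j h).le
  have hall : ∀ᶠ n : ℕ in atTop, ∀ k, k ≠ best →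
      ∫ ω, (pulls (oneBitPolicy g tie) messagePolicy (fun k j => X k j ω) n k : ℝ) ∂P
        ≤ c * ∫ ω, (pulls (ucbPolicy g tie') fullReward (fun k j => X k j ω) n k : ℝ) ∂P :=
    eventually_all.2 fun k => by
      by_cases hk : k = best
      · exact .of_forall fun _ h => absurd hk h
      · filter_upwards [eventually_integral_pulls_oneBit_le hg₁ hg₂ hg₃ hg₄ hg₅ tie tie' hX hident
          hle (hbest k hk) (hpos k) hb1 hc] with n hn _ using hn
  filter_upwards [hall] with n hn
  have e1 : regret P μ X (oneBitPolicy g tie) messagePolicy n = ∑ k, ((⨆ j, μ j) - μ k) *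
      ∫ ω, (pulls (oneBitPolicy g tie) messagePolicy (fun k j => X k j ω) n k : ℝ) ∂P :=
    regret_eq_sum tie _ bit X P (measurable_oneBit_index hg₁ hX) μ n
  have e2 : regret P μ X (ucbPolicy g tie') fullReward n = ∑ k, ((⨆ j, μ j) - μ k) *
      ∫ ω, (pulls (ucbPolicy g tie') fullReward (fun k j => X k j ω) n k : ℝ) ∂P :=
    regret_eq_sum tie' _ lastReward X P (measurable_ucb_index hg₁ hX) μ n
  rw [e1, e2, iSup_mean_eq hle, Finset.mul_sum]
  refine Finset.sum_le_sum fun k _ => ?_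
  rcases eq_or_ne k best with rfl | hk
  · simp
  · rw [mul_left_comm]
    exact mul_le_mul_of_nonneg_left (hn k hk) (sub_nonneg.2 (hle k))

end Comparison

end OneBit

theorem theorem1 {K : ℕ} (hK : 2 ≤ K)
    {Ω : Type*} [MeasurableSpace Ω] (P : Measure Ω) [IsProbabilityMeasure P]
    (ν : Fin K → Measure ℝ) (X : Fin K → ℕ → Ω → ℝ)
    (hX_meas : ∀ k j, Measurable (X k j))
    (hX_mem : ∀ k j ω, X k j ω ∈ Set.Icc (0 : ℝ) 1)
    (hX_law : ∀ k j, P.map (X k j) = ν k)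
    (hX_indep : ∀ k, iIndepFun (X k) P)
    (best : Fin K)
    (h_best : ∀ k, k ≠ best → OneBit.armMean ν k < OneBit.armMean ν best)
    (h_pos : ∀ k, 0 < OneBit.armMean ν k)
    (h_lt_one : OneBit.armMean ν best < 1)
    (g : ℕ → ℝ → ℕ → ℝ)
    (hg₁ : OneBit.Monotonicity g)
    (hg₂ : OneBit.ConvergesToAverage g)
    (hg₃ : OneBit.SufficientlyAbove g)
    (hg₄ : OneBit.Sublinear g)
    (hg₅ : OneBit.AsymptoticContinuity g)
    (tie tie' : OneBit.TieBreak K) :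
    (∀ n, 2 ≤ n →
      0 < OneBit.regret P (OneBit.armMean ν) X (OneBit.ucbPolicy g tie') OneBit.fullReward n) ∧
    limsup (fun n : ℕ =>
      ((OneBit.regret P (OneBit.armMean ν) X (OneBit.oneBitPolicy g tie) OneBit.messagePolicy n /
        OneBit.regret P (OneBit.armMean ν) X (OneBit.ucbPolicy g tie') OneBit.fullReward n : ℝ) :
          EReal)) atTop ≤ 1 := by
  have hmean : ∀ k j, ∫ ω, X k j ω ∂P = OneBit.armMean ν k := fun k j => by
    rw [OneBit.armMean, ← hX_law k j]
    exact (integral_map (hX_meas k j).aemeasurable aestronglyMeasurable_id).symm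
  have hX : ∀ k, OneBit.IndepUnitSeq P (OneBit.armMean ν k) (X k) := fun k =>
    ⟨hX_meas k, hX_mem k, hX_indep k, hmean k⟩
  have hident : ∀ k j, IdentDistrib (X k j) (X k 0) P P := fun k j =>
    ⟨(hX_meas k j).aemeasurable, (hX_meas k 0).aemeasurable, by rw [hX_law, hX_law]⟩
  refine ⟨fun n hn => OneBit.regret_ucb_pos hK hg₁ tie' hX h_best hn, ?_⟩
  -- In `EReal` it suffices to bound the limsup by every real `c > 1`.
  refine EReal.le_of_forall_lt_iff_le.1 fun c hc => limsup_le_of_le (h := ?_)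
  have hc : 1 < c := by exact_mod_cast hc
  filter_upwards [OneBit.eventually_regret_oneBit_le hg₁ hg₂ hg₃ hg₄ hg₅ tie tie' hX hident h_best
    h_pos h_lt_one hc, eventually_ge_atTop 2] with n hn hn2
  exact EReal.coe_le_coe_iff.2
    ((div_le_iff₀ (OneBit.regret_ucb_pos hK hg₁ tie' hX h_best hn2)).2 hn)
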